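/- Let $k$ be a field, let $n\ge 1$ and $d\ge 4$ be integers, and let $G$ be a finite simple graph on the vertex set $[n]=\{1,\dots,n\}$. The Lovász–Saks–Schrijver ideal of $G$ is the ideal $$L_G(d)=\Big(\sum_{\ell=1}^d x_{i\ell}x_{j\ell}\ \Big|\ \{i,j\}\in E(G)\Big)\subseteq S=k[x_{i\ell}\mid i\in[n],\ \ell\in[d]].$$ An ideal is a complete intersection if its minimal number of generators equals its height. An ideal $I$ of $S$ is an almost complete intersection if its minimal number of generators is one more than its height and, for every minimal prime $\mathfrak p$ of $I$, the localization $I_{\mathfrak p}$ is a complete intersection. Let $\Delta(G)$ denote the maximal degree of a vertex of $G$. A graph is unicyclic if it contains exactly one cycle as a subgraph. The word bicyclic is used in one of the following two senses, the same one throughout: (i) the graph contains exactly two cycles as subgraphs; (ii) the graph is connected and has exactly one edge more than it has vertices (this also allows theta graphs such as $K_{2,3}$). Theorem. Let $G$ be connected, bicyclic and $C_3$-free, with $\Delta(G)>d$. For either sense of bicyclic, $L_G(d)$ is an almost complete intersection if and only if $G$ has one of the following forms: 1. $G$ is obtained by adding a new edge between two distinct non-adjacent vertices of a unicyclic graph $U$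 with $V(U)=V(G)$ and $\Delta(U)\le d$; 2. $G$ is obtained from two vertex-disjoint unicyclic graphs $U_1,U_2$ with $V(U_1)\sqcup V(U_2)=V(G)$ and $\Delta(U_1),\Delta(U_2)\le d$ by adding an edge between a vertex of $U_1$ and a vertex of $U_2$; 3. $G$ is obtained from a tree $H$ and a bicyclic graph $B$, vertex-disjoint, with $V(H)\sqcup V(B)=V(G)$ and $\Delta(H),\Delta(B)\le d$, by adding an edge between a vertex of $H$ and a vertex of $B$. -/

import Mathlib

universe u v

namespace LSS

/-! ### Complete and almost complete intersection ideals -/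

/-- An ideal is a complete intersection if the minimal number of its generators equals its
height. -/
def IsCompleteIntersection {R : Type u} [CommRing R] (I : Ideal R) : Prop :=
  I.FG ∧ (Submodule.spanFinrank I : ℕ∞) = I.height

/-- An ideal `I` is an almost complete intersection if the minimal number of its generators is
one more than its height and the localization `I_p` is a complete intersection for every minimal
prime `p` of `I`. -/
def IsAlmostCompleteIntersection {R : Type u} [CommRing R] (I : Ideal R) : Prop :=
  I.FG ∧ (Submodule.spanFinrank I : ℕ∞) = I.height + 1 ∧
    ∀ (p : Ideal R) [p.IsPrime], p ∈ I.minimalPrimes →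
      IsCompleteIntersection (I.map (algebraMap R (Localization.AtPrime p)))

/-- The Lovász–Saks–Schrijver ideal `L_G(d)` in the polynomial ring with variables `x_{i l}`,
`i` a vertex and `l` in `{1, …, d}`. -/
noncomputable def lssIdeal (k : Type u) [Field k] {V : Type v} (d : ℕ) (G : SimpleGraph V) :
    Ideal (MvPolynomial (V × Fin d) k) :=
  Ideal.span {f | ∃ i j : V, G.Adj i j ∧
    f = ∑ l : Fin d, MvPolynomial.X (i, l) * MvPolynomial.X (j, l)}

/-! ### Graphs -/

open Classical in
/-- The maximal degree `Δ(G)` of a finite graph. -/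
noncomputable def maxDeg {V : Type v} [Finite V] (G : SimpleGraph V) : ℕ :=
  letI := Fintype.ofFinite V
  G.maxDegree

/-- The cycles of `G`, as subgraphs of `G` (so a cycle is counted once, whatever its starting
point and its orientation). -/
def cycles {V : Type v} (G : SimpleGraph V) : Set G.Subgraph :=
  {C | ∃ (w : V) (p : G.Walk w w), p.IsCycle ∧ p.toSubgraph = C}

/-- A graph is unicyclic if it contains exactly one cycle. -/
def IsUnicyclic {V : Type v} (G : SimpleGraph V) : Prop := (cycles G).encard = 1

/-- A graph is bicyclic if it contains exactly two cycles. -/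
def IsBicyclic {V : Type v} (G : SimpleGraph V) : Prop := (cycles G).encard = 2

/-- Bicyclic in the sense of cyclomatic number two: connected, with one edge more than vertices.
This also admits theta graphs, such as `K_{2,3}`, which contain three cycles. -/
def IsCyclomaticBicyclic {V : Type v} (G : SimpleGraph V) : Prop :=
  G.Connected ∧ G.edgeSet.encard = ENat.card V + 1

/-- `G` is obtained by adding one new edge between two vertices of `U`. -/
def IsEdgeAddition {V : Type v} (G U : SimpleGraph V) : Prop :=
  ∃ a b : V, a ≠ b ∧ ¬ U.Adj a b ∧ G = U ⊔ SimpleGraph.edge a b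

/-- `G` is obtained from the vertex-disjoint graphs `H₁` (with vertex set `A`) and `H₂` (with
vertex set `B`), `V(G) = A ⊔ B`, by adding one edge between a vertex of `H₁` and a vertex of
`H₂`. -/
def IsEdgeJoin {V : Type v} (G : SimpleGraph V) {A B : Set V}
    (H₁ : SimpleGraph A) (H₂ : SimpleGraph B) : Prop :=
  IsCompl A B ∧ ∃ (a : A) (b : B),
    G = H₁.map (Function.Embedding.subtype _) ⊔ H₂.map (Function.Embedding.subtype _) ⊔
      SimpleGraph.edge (a : V) (b : V)

/-- The three ways of building `G` by adding an edge to graphs of maximal degree at most `d`.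
The notion of a bicyclic graph is a parameter. -/
def IsBuiltByEdge {V : Type v} [Finite V] (Bic : ∀ ⦃W : Type v⦄, SimpleGraph W → Prop)
    (d : ℕ) (G : SimpleGraph V) : Prop :=
  (∃ U : SimpleGraph V, IsUnicyclic U ∧ maxDeg U ≤ d ∧ IsEdgeAddition G U) ∨
  (∃ (A B : Set V) (U₁ : SimpleGraph A) (U₂ : SimpleGraph B),
    IsUnicyclic U₁ ∧ maxDeg U₁ ≤ d ∧ IsUnicyclic U₂ ∧ maxDeg U₂ ≤ d ∧ IsEdgeJoin G U₁ U₂) ∨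
  (∃ (A B : Set V) (H : SimpleGraph A) (K : SimpleGraph B),
    H.IsTree ∧ maxDeg H ≤ d ∧ Bic K ∧ maxDeg K ≤ d ∧ IsEdgeJoin G H K)

end LSS

/-! Either sense of bicyclic gives a connected graph with `|E| = |V| + 1`. Everything passes through
one condition: some edge `ab` satisfies `Δ(G - ab) ≤ d`.

Necessity. The edge generators are minimal (`spanFinrank_lssIdeal`), so the height must be `|E| -
1`. Setting the vectors of a vertex set `Z` to zero bounds the height by `|Z| d + e(V \ Z)`
(`height_lssIdeal_le`). Hence degrees are at most `d + 1`, and vertices of degree `d + 1` are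
pairwise adjacent. As there are no triangles, there are at most two of them, and one edge meets them
all.

Sufficiency. A prime containing the ideal of a graph is studied through its generic point, a family
of mutually orthogonal vectors over the residue field. Its height is bounded below by adjoining
vectors one at a time; each coordinate that is rational in the earlier ones raises the height by
one. Every vertex set `W` spans at most `|W| + 1` edges, so a vertex can always be peeled off whose
vector accounts for all its edges, provided zero vectors only occur at vertices of degree at most
`d` (`edgesIn_le_blockHeight`). Applied to `G - ab` this gives height at least `|E| - 1`. At a
minimal prime where a vertex of degree above `d` has zero vector, its neighbors span the whole
space, and Cramer's rule makes one generator redundant after localization (`exists_mul_lssGen_mem`).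
At any other minimal prime, peeling `G` itself gives height at least `|E|`. Both cases are local
complete intersections.

Finally, the condition on `ab` is matched with the three forms: if `ab` is not a bridge, the first
form arises; if it is, counting edges on its two sides gives the second or the third
(`isBuiltByEdge_of_exists_edge`). -/

namespace LSS

open MvPolynomial

/-! ### Heights of ideals of relations. -/

section PartialEval

variable {k : Type*} [Field k] {σ : Type*} {K : Type*} [Field K] [Algebra k K]

open Classical in
/-- The substitution that evaluates the variables of `A` at the point `v` and keeps the other
variables free. -/
noncomputable def partialEval (v : σ → K) (A : Set σ) : MvPolynomial σ k →ₐ[k] MvPolynomial σ K :=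
  aeval (fun x => if x ∈ A then C (v x) else X x)

/-- The prime ideal of polynomial relations among the `v x` with `x ∈ A`, extended to all
variables. -/
noncomputable def relIdeal (k : Type*) [Field k] {σ : Type*} {K : Type*} [Field K] [Algebra k K]
    (v : σ → K) (A : Set σ) : Ideal (MvPolynomial σ k) :=
  RingHom.ker (partialEval (k := k) v A)

instance (v : σ → K) (A : Set σ) : (relIdeal k v A).IsPrime :=
  RingHom.ker_isPrime _

lemma mem_relIdeal {v : σ → K} {A : Set σ} {f : MvPolynomial σ k} :
    f ∈ relIdeal k v A ↔ partialEval v A f = 0 := RingHom.mem_ker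

lemma relIdeal_mono (v : σ → K) {A B : Set σ} (h : A ⊆ B) : relIdeal k v A ≤ relIdeal k v B := by
  classical
  have key : (partialEval (k := k) v B) =
      ((aeval (fun x => if x ∈ B then C (v x) else X x) :
        MvPolynomial σ K →ₐ[K] MvPolynomial σ K).restrictScalars k).comp (partialEval v A) := by
    ext1 x
    by_cases hA : x ∈ A
    · simp [partialEval, hA, h hA]
    · simp [partialEval, hA]
  intro f hf
  rw [mem_relIdeal] at hf ⊢
  rw [key, AlgHom.comp_apply, hf, map_zero]

lemma relIdeal_univ (v : σ → K) : relIdeal k v Set.univ = RingHom.ker (aeval (R := k) v) := by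
  have key : (partialEval (k := k) v Set.univ) =
      ((Algebra.ofId K (MvPolynomial σ K)).restrictScalars k).comp (aeval v) := by
    ext1 x
    simp [partialEval, Algebra.ofId_apply, algebraMap_eq]
  ext f
  rw [mem_relIdeal, RingHom.mem_ker, key, AlgHom.comp_apply, AlgHom.restrictScalars_apply,
    Algebra.ofId_apply, algebraMap_eq, C_eq_zero]

lemma partialEval_of_mem_adjoin (v : σ → K) {A : Set σ} {f : MvPolynomial σ k}
    (hf : f ∈ Algebra.adjoin k ((X : σ → MvPolynomial σ k) '' A)) :
    partialEval v A f = C (aeval v f) := by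
  induction hf using Algebra.adjoin_induction with
  | mem x hx => obtain ⟨i, hi, rfl⟩ := hx; simp [partialEval, hi]
  | algebraMap r =>
    rw [AlgHom.commutes, AlgHom.commutes, IsScalarTower.algebraMap_apply k K (MvPolynomial σ K)]
    rfl
  | add x y _ _ hx hy => simp [hx, hy]
  | mul x y _ _ hx hy => simp [hx, hy]

lemma exists_mem_adjoin_X (v : σ → K) {A : Set σ} {a : K} (ha : a ∈ Algebra.adjoin k (v '' A)) :
    ∃ f ∈ Algebra.adjoin k ((X : σ → MvPolynomial σ k) '' A), aeval v f = a := by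
  have : v '' A = aeval (R := k) v '' (X '' A) := by
    rw [Set.image_image]; simp
  rw [this, Algebra.adjoin_image] at ha
  simpa using ha

/-- Writing `v x = a / b` with `a`, `b` polynomial in the values on `A`, the relation `b X x - a` is
new: over `A` alone `X x` stays free and has the nonzero coefficient `b`. -/
lemma relIdeal_lt_insert (v : σ → K) {A : Set σ} {x : σ} (hx : x ∉ A)
    (hv : v x ∈ IntermediateField.adjoin k (v '' A)) :
    relIdeal k v A < relIdeal k v (insert x A) := by
  refine lt_of_le_of_ne (relIdeal_mono v (Set.subset_insert _ _)) ?_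
  obtain ⟨a, ha, b, hb, hb0, hab⟩ : ∃ a ∈ Algebra.adjoin k (v '' A),
      ∃ b ∈ Algebra.adjoin k (v '' A), b ≠ 0 ∧ b * v x = a := by
    obtain ⟨r, hr, s, hs, h⟩ := IntermediateField.mem_adjoin_iff_div.1 hv
    by_cases hs0 : s = 0
    -- A zero denominator means `v x = r / 0 = 0`, which is the fraction `0 / 1`.
    · exact ⟨0, zero_mem _, 1, one_mem _, one_ne_zero, by simp [h, hs0]⟩
    · exact ⟨r, hr, s, hs, hs0, by rw [h]; field_simp⟩
  obtain ⟨a', ha', rfl⟩ := exists_mem_adjoin_X v ha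
  obtain ⟨b', hb', rfl⟩ := exists_mem_adjoin_X v hb
  intro heq
  have hmono : Algebra.adjoin k ((X : σ → MvPolynomial σ k) '' A) ≤
      Algebra.adjoin k (X '' (insert x A)) :=
    Algebra.adjoin_mono (Set.image_mono (Set.subset_insert _ _))
  have h1 : b' * X x - a' ∈ relIdeal k v (insert x A) := by
    rw [mem_relIdeal, map_sub, map_mul, partialEval_of_mem_adjoin v (hmono hb'),
      partialEval_of_mem_adjoin v (hmono ha')]
    simp [partialEval, ← hab]
  rw [← heq, mem_relIdeal, map_sub, map_mul, partialEval_of_mem_adjoin v hb',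
    partialEval_of_mem_adjoin v ha'] at h1
  apply hb0
  generalize aeval v b' = b at h1
  generalize aeval v a' = a at h1
  have h2 := congrArg (coeff (Finsupp.single x 1)) h1
  classical
  have h0 : (0 : σ →₀ ℕ) ≠ Finsupp.single x 1 := (Finsupp.single_ne_zero.2 one_ne_zero).symm
  simpa [partialEval, hx, coeff_C_mul, coeff_C, h0] using h2

/-- The height of the ideal of relations among the `v x` with `x ∈ A`. -/
noncomputable def relHeight (k : Type*) [Field k] {σ : Type*} {K : Type*} [Field K] [Algebra k K]
    (v : σ → K) (A : Set σ) : ℕ∞ := (relIdeal k v A).height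

lemma relHeight_mono (v : σ → K) {A B : Set σ} (h : A ⊆ B) : relHeight k v A ≤ relHeight k v B :=
  Ideal.height_mono (relIdeal_mono v h)

/-- Adjoining the elements of `D` one by one gives a strictly increasing chain of primes. -/
lemma relHeight_add_card_le (v : σ → K) {A : Set σ} (D : Finset σ) (hD : ∀ x ∈ D, x ∉ A)
    (hv : ∀ x ∈ D, v x ∈ IntermediateField.adjoin k (v '' A)) :
    relHeight k v A + D.card ≤ relHeight k v (A ∪ D) := by
  classical
  induction D using Finset.induction_on with
  | empty => simp
  | insert x D hx ih =>
    have h1 := ih (fun y hy => hD y (Finset.mem_insert_of_mem hy))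
      (fun y hy => hv y (Finset.mem_insert_of_mem hy))
    have hlt : relIdeal k v (A ∪ D) < relIdeal k v (insert x (A ∪ D)) := by
      apply relIdeal_lt_insert
      · simp [hx, hD x (Finset.mem_insert_self _ _)]
      · exact IntermediateField.adjoin.mono _ _ _ (Set.image_mono Set.subset_union_left)
          (hv x (Finset.mem_insert_self _ _))
    have h2 := Ideal.height_add_one_le_of_lt_of_isPrime hlt
    have h3 : A ∪ ((insert x D : Finset σ) : Set σ) = insert x (A ∪ D) := by
      rw [Finset.coe_insert, Set.union_insert]
    rw [h3, Finset.card_insert_of_notMem hx]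
    push_cast
    rw [← add_assoc]
    exact (add_le_add_left h1 1).trans h2

end PartialEval

/-! ### Height gained by adjoining one vector. -/

section Blocks

variable {k : Type*} [Field k] {V : Type*} {d : ℕ} {K : Type*} [Field K] [Algebra k K]

/-- The height of the ideal of relations among the coordinates of the vectors `x i`, `i ∈ W`. -/
noncomputable def blockHeight (k : Type*) [Field k] {V : Type*} {d : ℕ} {K : Type*} [Field K]
    [Algebra k K] (x : V → Fin d → K) (W : Set V) : ℕ∞ :=
  relHeight k (fun a : V × Fin d => x a.1 a.2) (Prod.fst ⁻¹' W)

lemma blockHeight_mono (x : V → Fin d → K) {W W' : Set V} (h : W ⊆ W') :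
    blockHeight k x W ≤ blockHeight k x W' :=
  relHeight_mono _ (Set.preimage_mono h)

section

variable (k) (x : V → Fin d → K) (W : Set V) (i : V) (D : Finset (Fin d))

/-- The field generated by the vectors in `W` and the coordinates of `x i` outside `D`. -/
abbrev blockField : IntermediateField k K :=
  IntermediateField.adjoin k ((fun a : V × Fin d => x a.1 a.2) ''
      (Prod.fst ⁻¹' W ∪ {a | a.1 = i ∧ a.2 ∉ D}))

variable {k x W i D}

lemma mem_blockField {a : V} (ha : a ∈ W) (l : Fin d) : x a l ∈ blockField k x W i D :=
  IntermediateField.subset_adjoin _ _ ⟨(a, l), Or.inl ha, rfl⟩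

lemma mem_blockField_self {l : Fin d} (hl : l ∉ D) : x i l ∈ blockField k x W i D :=
  IntermediateField.subset_adjoin _ _ ⟨(i, l), Or.inr ⟨rfl, hl⟩, rfl⟩

end

/-- The coordinates of `x i` outside `D` are adjoined first, which cannot lower the height; each
coordinate in `D` then adds one. -/
lemma blockHeight_add_card_le (x : V → Fin d → K) {W : Set V} {i : V} (hi : i ∉ W)
    (D : Finset (Fin d)) (hD : ∀ l ∈ D, x i l ∈ blockField k x W i D) :
    blockHeight k x W + D.card ≤ blockHeight k x (insert i W) := by
  classical
  have h := relHeight_add_card_le (k := k) (fun a : V × Fin d => x a.1 a.2)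
    (A := Prod.fst ⁻¹' W ∪ {a | a.1 = i ∧ a.2 ∉ D}) (D.image (Prod.mk i))
    (by
      intro a ha
      obtain ⟨l, hl, rfl⟩ := Finset.mem_image.1 ha
      simp [hi, hl])
    (by
      intro a ha
      obtain ⟨l, hl, rfl⟩ := Finset.mem_image.1 ha
      exact hD l hl)
  rw [Finset.card_image_of_injective _ (Prod.mk_right_injective i)] at h
  refine le_trans (add_le_add_left (relHeight_mono _ Set.subset_union_left) _)
    (h.trans (relHeight_mono _ ?_))
  rintro ⟨j, l⟩ (h | h)
  · rcases h with h | h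
    · exact Or.inr h
    · exact Or.inl h.1
  · obtain ⟨l', _, h⟩ := Finset.mem_image.1 (Finset.mem_coe.1 h)
    exact Or.inl (Prod.ext_iff.1 h).1.symm

/-- Two vectors are parallel if their `2 × 2` minors vanish. -/
def Parallel (a b : Fin d → K) : Prop := ∀ c l, a c * b l = a l * b c

lemma blockHeight_add_of_eq_zero (x : V → Fin d → K) {W : Set V} {i : V} (hi : i ∉ W)
    (h : x i = 0) : blockHeight k x W + d ≤ blockHeight k x (insert i W) := by
  simpa using blockHeight_add_card_le (k := k) x hi Finset.univ
    (fun l _ => by rw [h]; exact zero_mem _)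

/-- The orthogonality equation is solved for a coordinate `c` with `x a c ≠ 0`. -/
lemma blockHeight_add_one (x : V → Fin d → K) {W : Set V} {i a : V} (hi : i ∉ W)
    (ha : a ∈ W) (ha0 : x a ≠ 0) (h : x a ⬝ᵥ x i = 0) :
    blockHeight k x W + 1 ≤ blockHeight k x (insert i W) := by
  classical
  obtain ⟨c, hc⟩ := Function.ne_iff.1 ha0
  have hc : x a c ≠ 0 := hc
  have h0 := blockHeight_add_card_le (k := k) x hi {c} ?_
  · simpa using h0
  intro l hl
  obtain rfl := Finset.mem_singleton.1 hl
  have h1 : x i l = - (∑ m ∈ Finset.univ.erase l, x a m * x i m) / x a l := by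
    rw [dotProduct, ← Finset.add_sum_erase _ _ (Finset.mem_univ l)] at h
    rw [eq_div_iff hc]
    linear_combination h
  rw [h1]
  refine div_mem (neg_mem (sum_mem fun m hm => mul_mem (mem_blockField ha m)
    (mem_blockField_self ?_))) (mem_blockField ha l)
  simpa using Finset.ne_of_mem_erase hm

/-- One coordinate `c` with `x a c ≠ 0` fixes the scaling factor and hence all the others. -/
lemma blockHeight_add_of_parallel (x : V → Fin d → K) {W : Set V} {i a : V} (hi : i ∉ W)
    (ha : a ∈ W) (ha0 : x a ≠ 0) (h : Parallel (x a) (x i)) :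
    blockHeight k x W + (d - 1 : ℕ) ≤ blockHeight k x (insert i W) := by
  classical
  obtain ⟨c, hc⟩ := Function.ne_iff.1 ha0
  have hc : x a c ≠ 0 := hc
  have := blockHeight_add_card_le (k := k) x hi (Finset.univ.erase c) ?_
  · simpa [Finset.card_erase_of_mem] using this
  intro l hl
  have h1 : x i l = x a l * x i c / x a c := by
    rw [eq_div_iff hc, ← h c l]; ring
  rw [h1]
  exact div_mem (mul_mem (mem_blockField ha l) (mem_blockField_self (by simp)))
    (mem_blockField ha c)

/-- A nonzero `2 × 2` minor in columns `c`, `l` lets Cramer's rule solve both equations for these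
two coordinates. -/
lemma blockHeight_add_two (x : V → Fin d → K) {W : Set V} {i a b : V} (hi : i ∉ W)
    (ha : a ∈ W) (hb : b ∈ W) (hab : ¬ Parallel (x a) (x b)) (hai : x a ⬝ᵥ x i = 0)
    (hbi : x b ⬝ᵥ x i = 0) :
    blockHeight k x W + 2 ≤ blockHeight k x (insert i W) := by
  classical
  simp only [Parallel, not_forall] at hab
  obtain ⟨c, l, hcl⟩ := hab
  have hne : c ≠ l := by rintro rfl; exact hcl rfl
  have hdet : x a c * x b l - x a l * x b c ≠ 0 := sub_ne_zero.2 hcl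
  have hmem : ∀ y : V, y ∈ W → (∑ m ∈ (Finset.univ.erase c).erase l, x y m * x i m) ∈
      blockField k x W i {c, l} := fun y hy =>
    sum_mem fun m hm => mul_mem (mem_blockField hy m) (mem_blockField_self (by
      have h1 := Finset.ne_of_mem_erase hm
      have h2 := Finset.ne_of_mem_erase (Finset.mem_of_mem_erase hm)
      simp [h1, h2]))
  have hsum : ∀ y : V, x y ⬝ᵥ x i = x y c * x i c + (x y l * x i l +
      ∑ m ∈ (Finset.univ.erase c).erase l, x y m * x i m) := fun y => by
    rw [Finset.add_sum_erase _ (fun m => x y m * x i m) (by simp [hne.symm]),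
      Finset.add_sum_erase _ (fun m => x y m * x i m) (Finset.mem_univ c), dotProduct]
  rw [hsum] at hai hbi
  have h0 := blockHeight_add_card_le (k := k) x hi {c, l} ?_
  · simpa [Finset.card_pair hne] using h0
  have hA := hmem a ha
  have hB := hmem b hb
  set P := ∑ m ∈ (Finset.univ.erase c).erase l, x a m * x i m
  set Q := ∑ m ∈ (Finset.univ.erase c).erase l, x b m * x i m
  have hc1 : x i c = (x a l * Q - x b l * P) / (x a c * x b l - x a l * x b c) := by
    rw [eq_div_iff hdet]; linear_combination x b l * hai - x a l * hbi
  have hl1 : x i l = (x b c * P - x a c * Q) / (x a c * x b l - x a l * x b c) := by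
    rw [eq_div_iff hdet]; linear_combination x a c * hbi - x b c * hai
  have hdm : x a c * x b l - x a l * x b c ∈ blockField k x W i {c, l} :=
    sub_mem (mul_mem (mem_blockField ha _) (mem_blockField hb _))
      (mul_mem (mem_blockField ha _) (mem_blockField hb _))
  intro m hm
  rcases Finset.mem_insert.1 hm with rfl | hm
  · rw [hc1]
    exact div_mem (sub_mem (mul_mem (mem_blockField ha _) hB)
      (mul_mem (mem_blockField hb _) hA)) hdm
  · obtain rfl := Finset.mem_singleton.1 hm
    rw [hl1]
    exact div_mem (sub_mem (mul_mem (mem_blockField hb _) hA)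
      (mul_mem (mem_blockField ha _) hB)) hdm

end Blocks

/-! ### Peeling vertices off a sparse graph. -/

section Peeling

variable {V : Type*} [DecidableEq V] (G : SimpleGraph V) [DecidableRel G.Adj]

/-- The number of neighbors of `i` in `W`. -/
def degIn (W : Finset V) (i : V) : ℕ := (W.filter (G.Adj i)).card

/-- The number of edges of `G` with both ends in `W`. -/
def edgesIn (W : Finset V) : ℕ := (W.sym2.filter (· ∈ G.edgeSet)).card

lemma edgesIn_insert {W : Finset V} {i : V} (hi : i ∉ W) :
    edgesIn G (insert i W) = edgesIn G W + degIn G W i := by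
  have h1 : (insert i W).sym2.filter (· ∈ G.edgeSet) =
      W.sym2.filter (· ∈ G.edgeSet) ∪ (W.filter (G.Adj i)).image (fun j => s(i, j)) := by
    ext e
    induction e with | _ a b
    simp only [Finset.mem_filter, Finset.mk_mem_sym2_iff, Finset.mem_insert, Finset.mem_union,
      Finset.mem_image, SimpleGraph.mem_edgeSet]
    constructor
    · rintro ⟨⟨rfl | ha, rfl | hb⟩, h⟩
      · exact absurd h (G.loopless.irrefl _)
      · exact Or.inr ⟨b, ⟨hb, h⟩, rfl⟩
      · exact Or.inr ⟨a, ⟨ha, h.symm⟩, Sym2.eq_swap⟩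
      · exact Or.inl ⟨⟨ha, hb⟩, h⟩
    · rintro (⟨⟨ha, hb⟩, h⟩ | ⟨j, ⟨hj, h⟩, he⟩)
      · exact ⟨⟨Or.inr ha, Or.inr hb⟩, h⟩
      · rcases Sym2.eq_iff.1 he with ⟨rfl, rfl⟩ | ⟨rfl, rfl⟩
        · exact ⟨⟨Or.inl rfl, Or.inr hj⟩, h⟩
        · exact ⟨⟨Or.inr hj, Or.inl rfl⟩, h.symm⟩
  rw [edgesIn, h1, Finset.card_union_of_disjoint, Finset.card_image_of_injective, edgesIn, degIn]
  · intro a b h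
    exact Sym2.congr_right.1 h
  · rw [Finset.disjoint_right]
    intro e he he'
    obtain ⟨j, _, rfl⟩ := Finset.mem_image.1 he
    exact hi (Finset.mk_mem_sym2_iff.1 (Finset.mem_filter.1 he').1).1

lemma degIn_insert_self (W : Finset V) (i : V) : degIn G (insert i W) i = degIn G W i := by
  simp [degIn, Finset.filter_insert]

lemma degIn_erase_self (W : Finset V) (i : V) : degIn G (W.erase i) i = degIn G W i := by
  by_cases hi : i ∈ W
  · rw [← degIn_insert_self, Finset.insert_erase hi]
  · rw [Finset.erase_eq_of_notMem hi]

lemma edgesIn_erase {W : Finset V} {i : V} (hi : i ∈ W) :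
    edgesIn G W = edgesIn G (W.erase i) + degIn G W i := by
  rw [← degIn_erase_self, ← edgesIn_insert G (Finset.notMem_erase i W), Finset.insert_erase hi]

lemma degIn_insert {W : Finset V} {i : V} (hi : i ∉ W) (j : V) :
    degIn G (insert i W) j = degIn G W j + if G.Adj j i then 1 else 0 := by
  unfold degIn
  rw [Finset.filter_insert]
  split_ifs with h
  · rw [Finset.card_insert_of_notMem (by simp [hi])]
  · simp

lemma sum_degIn (W : Finset V) : ∑ i ∈ W, degIn G W i = 2 * edgesIn G W := by
  induction W using Finset.induction_on with
  | empty => simp [edgesIn]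
  | insert i W hi ih =>
    rw [Finset.sum_insert hi, degIn_insert_self, edgesIn_insert G hi]
    simp_rw [degIn_insert G hi]
    rw [Finset.sum_add_distrib, ih, ← Finset.card_filter, degIn]
    simp_rw [G.adj_comm _ i]
    ring

/-- In a graph with at most one more edge than vertices and minimal degree at least two there is a
vertex of degree two. -/
lemma exists_degIn_eq_two {W : Finset V} (hW : W.Nonempty) (he : edgesIn G W ≤ W.card + 1)
    (h2 : ∀ i ∈ W, 2 ≤ degIn G W i) : ∃ i ∈ W, degIn G W i = 2 := by
  by_contra! hcon
  have h3 : ∀ i ∈ W, 3 ≤ degIn G W i := fun i hi => by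
    have := h2 i hi; have := hcon i hi; omega
  -- Degrees at least three give `3|W| ≤ 2|W| + 2`, so `|W| ≤ 2`, too few vertices for degree three.
  have hs := Finset.card_nsmul_le_sum W (degIn G W) 3 h3
  rw [sum_degIn, smul_eq_mul] at hs
  obtain ⟨i, hi⟩ := hW
  have h5 : degIn G W i ≤ (W.erase i).card := by
    rw [← degIn_erase_self]; exact Finset.card_filter_le _ _
  rw [Finset.card_erase_of_mem hi] at h5
  have := h3 i hi
  omega

/-- In such a graph at most one vertex has degree larger than three. -/
lemma degIn_le_three {W : Finset V} (he : edgesIn G W ≤ W.card + 1)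
    (h2 : ∀ i ∈ W, 2 ≤ degIn G W i) {a b : V} (ha : a ∈ W) (hb : b ∈ W) (hab : a ≠ b) :
    degIn G W a ≤ 3 ∨ degIn G W b ≤ 3 := by
  by_contra! hcon
  have hs := sum_degIn G W
  have hb' : b ∈ W.erase a := Finset.mem_erase.2 ⟨hab.symm, hb⟩
  rw [← Finset.add_sum_erase _ _ ha, ← Finset.add_sum_erase _ _ hb'] at hs
  -- Two degrees of at least four would make the degree sum at least `2|W| + 4`, against `2|W| + 2`.
  have h1 : _ ≤ ∑ i ∈ (W.erase a).erase b, degIn G W i := Finset.card_nsmul_le_sum _ _ 2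
    (fun i hi => h2 i (Finset.mem_of_mem_erase (Finset.mem_of_mem_erase hi)))
  have hc1 := Finset.card_erase_add_one ha
  have hc2 := Finset.card_erase_add_one hb'
  rw [smul_eq_mul] at h1
  omega

variable {k : Type*} [Field k] {d : ℕ} {K : Type*} [Field K] [Algebra k K]

/-- The vertex to remove depends on the vectors. A zero vector gains `d`. Otherwise a vertex of
degree at most one gains its degree. Failing both, some vertex has degree two: it gains two if its
neighbors are not parallel, and if they are, one of the neighbors is removed instead. -/
lemma blockHeight_erase_add_degIn_le (hd : 4 ≤ d) (x : V → Fin d → K)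
    (hx : ∀ i j, G.Adj i j → x i ⬝ᵥ x j = 0) {W : Finset V} (hW : W.Nonempty)
    (he : edgesIn G W ≤ W.card + 1) (h0 : ∀ i ∈ W, x i = 0 → degIn G W i ≤ d) :
    ∃ i ∈ W, blockHeight k x ↑(W.erase i) + degIn G W i ≤ blockHeight k x (W : Set V) := by
  have hins : ∀ i ∈ W, (insert i (↑(W.erase i) : Set V)) = (W : Set V) := fun i hi => by
    rw [← Finset.coe_insert, Finset.insert_erase hi]
  have hni : ∀ i, i ∉ (↑(W.erase i) : Set V) := fun i => by simp
  have hgoal : ∀ i ∈ W, ∀ m : ℕ, degIn G W i ≤ m →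
      blockHeight k x (↑(W.erase i) : Set V) + m ≤
        blockHeight k x (insert i (↑(W.erase i) : Set V)) →
      ∃ i ∈ W, blockHeight k x ↑(W.erase i) + degIn G W i ≤ blockHeight k x (W : Set V) :=
    fun i hi m hm h => ⟨i, hi, by
      rw [hins i hi] at h
      exact (add_le_add_right (by exact_mod_cast hm) _).trans h⟩
  by_cases hz : ∃ i ∈ W, x i = 0
  · obtain ⟨i, hi, hxi⟩ := hz
    exact hgoal i hi d (h0 i hi hxi) (blockHeight_add_of_eq_zero (k := k) x (hni i) hxi)
  push Not at hz
  by_cases h1 : ∃ i ∈ W, degIn G W i ≤ 1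
  · obtain ⟨i, hi, hdi⟩ := h1
    rcases Nat.le_one_iff_eq_zero_or_eq_one.1 hdi with h | h
    · exact hgoal i hi 0 h.le (by
        rw [Nat.cast_zero, add_zero]
        exact blockHeight_mono x (Set.subset_insert _ _))
    · obtain ⟨a, ha⟩ := Finset.card_pos.1 (show 0 < degIn G W i by omega)
      obtain ⟨haW, hia⟩ := Finset.mem_filter.1 ha
      exact hgoal i hi 1 h.le (by
        rw [Nat.cast_one]
        exact blockHeight_add_one (k := k) x (hni i)
          (Finset.mem_coe.2 (Finset.mem_erase.2 ⟨hia.ne', haW⟩)) (hz a haW) (hx a i hia.symm))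
  push Not at h1
  obtain ⟨i, hi, hdi⟩ := exists_degIn_eq_two G hW he h1
  obtain ⟨a, b, hab, hN⟩ := Finset.card_eq_two.1 hdi
  have hmem : ∀ c, c ∈ ({a, b} : Finset V) → c ∈ W ∧ G.Adj i c := fun c hc => by
    rw [← hN] at hc; exact Finset.mem_filter.1 hc
  obtain ⟨ha, hia⟩ := hmem a (by simp)
  obtain ⟨hb, hib⟩ := hmem b (by simp)
  by_cases hpar : Parallel (x a) (x b)
  · have hpar' : Parallel (x b) (x a) := fun c l => by
      have := hpar l c; linear_combination this
    -- One of the parallel neighbors has degree at most three, which the gain `d - 1` covers; this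
    -- is where `4 ≤ d` enters.
    rcases degIn_le_three G he h1 ha hb hab with h | h
    · exact hgoal a ha (d - 1) (by omega) (blockHeight_add_of_parallel (k := k) x (hni a)
        (Finset.mem_coe.2 (Finset.mem_erase.2 ⟨hab.symm, hb⟩)) (hz b hb) hpar')
    · exact hgoal b hb (d - 1) (by omega) (blockHeight_add_of_parallel (k := k) x (hni b)
        (Finset.mem_coe.2 (Finset.mem_erase.2 ⟨hab, ha⟩)) (hz a ha) hpar)
  · exact hgoal i hi 2 hdi.le (by
      rw [Nat.cast_ofNat]
      exact blockHeight_add_two x (hni i)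
        (Finset.mem_coe.2 (Finset.mem_erase.2 ⟨hia.ne', ha⟩))
        (Finset.mem_coe.2 (Finset.mem_erase.2 ⟨hib.ne', hb⟩)) hpar (hx a i hia.symm)
        (hx b i hib.symm))

/-- The relations among vectors that satisfy the orthogonality conditions of a graph with few
cycles have at least the expected height. -/
theorem edgesIn_le_blockHeight (hd : 4 ≤ d) (x : V → Fin d → K)
    (hx : ∀ i j, G.Adj i j → x i ⬝ᵥ x j = 0)
    (he : ∀ W : Finset V, W.Nonempty → edgesIn G W ≤ W.card + 1)
    (h0 : ∀ (W : Finset V) (i : V), x i = 0 → degIn G W i ≤ d) (W : Finset V) :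
    (edgesIn G W : ℕ∞) ≤ blockHeight k x (W : Set V) := by
  induction hn : W.card generalizing W with
  | zero =>
    obtain rfl := Finset.card_eq_zero.1 hn
    simp [edgesIn]
  | succ n ih =>
    have hW : W.Nonempty := Finset.card_pos.1 (by omega)
    obtain ⟨i, hi, h⟩ := blockHeight_erase_add_degIn_le (k := k) G hd x hx hW (he W hW)
      (fun i _ h => h0 W i h)
    rw [edgesIn_erase G hi]
    push_cast
    exact (add_le_add_left (ih _ (by rw [Finset.card_erase_of_mem hi, hn]; rfl)) _).trans h

end Peeling

/-! ### Minimal generators and an upper bound for the height. -/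

section Generators

variable (k : Type*) [Field k] {V : Type*} (d : ℕ)

/-- The generator of the Lovász–Saks–Schrijver ideal that belongs to an edge. -/
noncomputable def lssGen : Sym2 V → MvPolynomial (V × Fin d) k :=
  Sym2.lift ⟨fun i j => ∑ l : Fin d, X (i, l) * X (j, l), fun _ _ => by simp_rw [mul_comm]⟩

@[simp] lemma lssGen_mk (i j : V) :
    lssGen k d s(i, j) = ∑ l : Fin d, X (i, l) * X (j, l) := rfl

lemma lssIdeal_eq_span (G : SimpleGraph V) :
    lssIdeal k d G = Ideal.span (lssGen k d '' G.edgeSet) := by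
  unfold lssIdeal
  congr 1
  ext f
  constructor
  · rintro ⟨i, j, h, rfl⟩
    exact ⟨s(i, j), h, rfl⟩
  · rintro ⟨e, he, rfl⟩
    induction e with | _ i j
    exact ⟨i, j, he, rfl⟩

lemma lssGen_mem {G : SimpleGraph V} {e : Sym2 V} (he : e ∈ G.edgeSet) :
    lssGen k d e ∈ lssIdeal k d G := by
  rw [lssIdeal_eq_span]
  exact Ideal.subset_span ⟨e, he, rfl⟩

lemma lssIdeal_fg [Finite V] (G : SimpleGraph V) : (lssIdeal k d G).FG := by
  rw [lssIdeal_eq_span]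
  exact Submodule.fg_span ((Set.toFinite _).image _)

lemma isHomogeneous_lssGen (e : Sym2 V) : (lssGen k d e).IsHomogeneous 2 := by
  induction e with | _ i j
  rw [lssGen_mk]
  exact IsHomogeneous.sum _ _ _ fun l _ => (isHomogeneous_X k _).mul (isHomogeneous_X k _)

/-- The square-free monomial of an edge in the variables with second index `l`. -/
noncomputable def edgeMonomial {d : ℕ} (l : Fin d) : Sym2 V → (V × Fin d →₀ ℕ) :=
  Sym2.lift ⟨fun i j => Finsupp.single (i, l) 1 + Finsupp.single (j, l) 1,
    fun _ _ => add_comm _ _⟩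

lemma degree_edgeMonomial {d : ℕ} (l : Fin d) (e : Sym2 V) : (edgeMonomial l e).degree = 2 := by
  induction e
  simp [edgeMonomial]

-- Fixing the second index `l` isolates one term of each generator, and these terms are distinct
-- monomials for distinct edges.
open Classical in
lemma coeff_edgeMonomial_lssGen {d : ℕ} (l : Fin d) (e e' : Sym2 V) :
    coeff (edgeMonomial l e) (lssGen k d e') = if e' = e then 1 else 0 := by
  induction e with | _ i j
  induction e' with | _ a b
  have h1 : ∀ m : Fin d, (X (a, m) * X (b, m) : MvPolynomial (V × Fin d) k) =
      monomial (Finsupp.single (a, m) 1 + Finsupp.single (b, m) 1) 1 := fun m => by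
    rw [X, X, monomial_mul, one_mul]
  have h2 : ∀ m : Fin d, (Finsupp.single (a, m) 1 + Finsupp.single (b, m) 1 =
      Finsupp.single (i, l) 1 + Finsupp.single (j, l) 1) ↔ (m = l ∧ s(a, b) = s(i, j)) := by
    intro m
    rw [Finsupp.single_add_single_eq_single_add_single one_ne_zero one_ne_zero, Sym2.eq_iff]
    simp only [Prod.mk.injEq]
    constructor
    · rintro (⟨⟨rfl, h⟩, rfl, _⟩ | ⟨_, ⟨rfl, h⟩, rfl, _⟩ | ⟨h, _⟩)
      · exact ⟨h, Or.inl ⟨rfl, rfl⟩⟩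
      · exact ⟨h, Or.inr ⟨rfl, rfl⟩⟩
      · omega
    · rintro ⟨rfl, ⟨rfl, rfl⟩ | ⟨rfl, rfl⟩⟩
      · exact Or.inl ⟨⟨rfl, rfl⟩, rfl, rfl⟩
      · exact Or.inr (Or.inl ⟨trivial, ⟨rfl, rfl⟩, rfl, rfl⟩)
  simp only [lssGen_mk, coeff_sum, edgeMonomial, Sym2.lift_mk, h1, coeff_monomial, h2]
  split_ifs with h <;> simp [h]

variable {k d}

lemma coeff_eq_zero_of_mem_lssIdeal {G : SimpleGraph V} {f : MvPolynomial (V × Fin d) k}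
    (hf : f ∈ lssIdeal k d G) (m : V × Fin d →₀ ℕ) (hm : m.degree < 2) : coeff m f = 0 := by
  classical
  rw [lssIdeal_eq_span] at hf
  induction hf using Submodule.span_induction generalizing m with
  | mem x hx =>
    obtain ⟨e, _, rfl⟩ := hx
    exact (isHomogeneous_lssGen k d e).coeff_eq_zero hm.ne
  | zero => simp
  | add x y _ _ hx hy => rw [coeff_add, hx m hm, hy m hm, add_zero]
  | smul a x _ hx =>
    rw [smul_eq_mul, coeff_mul]
    refine Finset.sum_eq_zero fun p hp => ?_
    rw [Finset.HasAntidiagonal.mem_antidiagonal] at hp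
    rw [hx p.2, mul_zero]
    have := congrArg Finsupp.degree hp
    rw [map_add] at this
    omega

/-- The ideal has no terms of degree below two, so quadratic coefficients only see the constant term
of the multiplier. This replaces passing to the quotient of the ideal by its product with the
irrelevant ideal. -/
lemma coeff_mul_of_mem_lssIdeal {G : SimpleGraph V} {f : MvPolynomial (V × Fin d) k}
    (hf : f ∈ lssIdeal k d G) (m : V × Fin d →₀ ℕ) (hm : m.degree = 2)
    (a : MvPolynomial (V × Fin d) k) : coeff m (a * f) = coeff 0 a * coeff m f := by
  classical
  rw [coeff_mul, Finset.sum_eq_single (0, m)]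
  · intro p hp hne
    rw [Finset.HasAntidiagonal.mem_antidiagonal] at hp
    rw [coeff_eq_zero_of_mem_lssIdeal hf p.2, mul_zero]
    have h1 := congrArg Finsupp.degree hp
    rw [map_add] at h1
    have h2 : p.1.degree ≠ 0 := by
      intro h0
      have h3 : p.1 = 0 := (Finsupp.degree_eq_zero_iff _).1 h0
      rw [h3, zero_add] at hp
      exact hne (Prod.ext h3 hp)
    omega
  · intro h
    exact absurd (Finset.HasAntidiagonal.mem_antidiagonal.2 (zero_add m)) h

/-- The generators of the Lovász–Saks–Schrijver ideal given by the edges are minimal. -/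
theorem spanFinrank_lssIdeal [Fintype V] (hd : 0 < d) (G : SimpleGraph V) [Fintype G.edgeSet] :
    Submodule.spanFinrank (lssIdeal k d G) = G.edgeFinset.card := by
  classical
  apply le_antisymm
  · rw [lssIdeal_eq_span]
    refine (Submodule.spanFinrank_span_le_ncard_of_finite ((Set.toFinite _).image _)).trans ?_
    refine (Set.ncard_image_le (Set.toFinite _)).trans ?_
    rw [Set.ncard_eq_toFinset_card', SimpleGraph.edgeFinset]
  · obtain ⟨s, hs, hspan⟩ :=
      Submodule.FG.exists_span_finset_card_eq_spanFinrank (lssIdeal_fg k d G)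
    rw [← hs]
    let l : Fin d := ⟨0, hd⟩
    let ψ : MvPolynomial (V × Fin d) k →ₗ[k] (G.edgeSet → k) :=
      LinearMap.pi fun e => lcoeff k (edgeMonomial l e.1)
    -- Ideal combinations of `s` become `k`-linear combinations under `ψ`, while the edge generators
    -- map to the standard basis; so `s` has at least as many elements as there are edges.
    have key : ∀ f ∈ Ideal.span (s : Set (MvPolynomial (V × Fin d) k)),
        ψ f ∈ Submodule.span k ((s.image ψ : Finset (G.edgeSet → k)) : Set (G.edgeSet → k)) := by
      intro f hf
      induction hf using Submodule.span_induction with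
      | mem x hx => exact Submodule.subset_span (by simpa using ⟨x, hx, rfl⟩)
      | zero => simp
      | add x y _ _ hx hy => rw [map_add]; exact add_mem hx hy
      | smul a x hxs hx =>
        have : ψ (a • x) = coeff 0 a • ψ x := by
          ext e
          exact coeff_mul_of_mem_lssIdeal (hspan ▸ hxs) _ (degree_edgeMonomial l e.1) a
        rw [this]
        exact Submodule.smul_mem _ _ hx
    have htop : Submodule.span k
        ((s.image ψ : Finset (G.edgeSet → k)) : Set (G.edgeSet → k)) = ⊤ := by
      rw [eq_top_iff, ← (Pi.basisFun k G.edgeSet).span_eq, Submodule.span_le]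
      rintro _ ⟨e, rfl⟩
      have h1 := key (lssGen k d e.1) (by
        have := lssGen_mem k d e.2
        rwa [← hspan] at this)
      have h2 : ψ (lssGen k d e.1) = Pi.basisFun k G.edgeSet e := by
        ext e'
        simp only [ψ, LinearMap.pi_apply, lcoeff_apply, coeff_edgeMonomial_lssGen,
          Pi.basisFun_apply, Pi.single_apply, Subtype.ext_iff, eq_comm]
      rwa [h2] at h1
    have h1 := finrank_span_finset_le_card (R := k) (s.image ψ)
    rw [Set.finrank, htop, finrank_top, Module.finrank_fintype_fun_eq_card] at h1
    rw [SimpleGraph.edgeFinset, Set.toFinset_card]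
    exact h1.trans Finset.card_image_le

/-- An upper bound for the height, from the vectors that vanish on a set of vertices. -/
theorem height_lssIdeal_le [Fintype V] [DecidableEq V] (G : SimpleGraph V) [DecidableRel G.Adj]
    (Z : Finset V) :
    (lssIdeal k d G).height ≤ ((Z.card * d + edgesIn G Zᶜ : ℕ) : ℕ∞) := by
  classical
  let s : Finset (MvPolynomial (V × Fin d) k) :=
    (Z ×ˢ (Finset.univ : Finset (Fin d))).image X ∪
      (Zᶜ.sym2.filter (· ∈ G.edgeSet)).image (lssGen k d)
  have hle : lssIdeal k d G ≤ Ideal.span (s : Set (MvPolynomial (V × Fin d) k)) := by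
    rw [lssIdeal_eq_span, Ideal.span_le]
    rintro _ ⟨e, he, rfl⟩
    induction e with | _ i j
    have hX : ∀ z ∈ Z, ∀ l : Fin d,
        (X (z, l) : MvPolynomial (V × Fin d) k) ∈ Ideal.span (s : Set (MvPolynomial _ k)) :=
      fun z hz l => Ideal.subset_span (Finset.mem_coe.2 (Finset.mem_union_left _
        (Finset.mem_image_of_mem _ (Finset.mem_product.2 ⟨hz, Finset.mem_univ _⟩))))
    by_cases hi : i ∈ Z
    · rw [lssGen_mk]
      exact sum_mem fun l _ => Ideal.mul_mem_right _ _ (hX i hi l)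
    by_cases hj : j ∈ Z
    · rw [lssGen_mk]
      exact sum_mem fun l _ => Ideal.mul_mem_left _ _ (hX j hj l)
    · refine Ideal.subset_span (Finset.mem_coe.2 (Finset.mem_union_right _
        (Finset.mem_image_of_mem _ (Finset.mem_filter.2 ⟨?_, he⟩))))
      rw [Finset.mk_mem_sym2_iff]
      simp [hi, hj]
  -- Krull's height theorem needs a proper ideal; all elements of `s` vanish at the origin.
  have hne : Ideal.span (s : Set (MvPolynomial (V × Fin d) k)) ≠ ⊤ := by
    intro h
    have hker : Ideal.span (s : Set (MvPolynomial (V × Fin d) k)) ≤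
        RingHom.ker (constantCoeff (R := k) (σ := V × Fin d)) := by
      rw [Ideal.span_le]
      intro f hf
      rcases Finset.mem_union.1 (Finset.mem_coe.1 hf) with hf | hf
      · obtain ⟨a, _, rfl⟩ := Finset.mem_image.1 hf
        simp
      · obtain ⟨e, _, rfl⟩ := Finset.mem_image.1 hf
        induction e
        simp
    rw [h] at hker
    exact (RingHom.ker_ne_top _) (top_le_iff.1 hker)
  refine (Ideal.height_mono hle).trans ((Ideal.height_le_spanFinrank _ hne).trans ?_)
  refine (Submodule.spanFinrank_span_le_encard _).trans ?_
  rw [Set.encard_coe_eq_coe_finsetCard, Nat.cast_le]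
  refine (Finset.card_union_le _ _).trans (add_le_add ?_ Finset.card_image_le)
  refine Finset.card_image_le.trans ?_
  simp

end Generators

/-! ### Generic points of minimal primes. -/

section MinimalPrimes

variable {k : Type*} [Field k] {V : Type*} {d : ℕ}

/-- The vectors over the residue field of a prime ideal that are given by the classes of the
variables. -/
noncomputable def genericPoint (p : Ideal (MvPolynomial (V × Fin d) k)) (i : V) (l : Fin d) :
    FractionRing (MvPolynomial (V × Fin d) k ⧸ p) :=
  algebraMap _ _ (Ideal.Quotient.mk p (X (i, l)))

variable (p : Ideal (MvPolynomial (V × Fin d) k))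

lemma aeval_genericPoint (f : MvPolynomial (V × Fin d) k) :
    aeval (fun a : V × Fin d => genericPoint p a.1 a.2) f =
      algebraMap _ (FractionRing (MvPolynomial (V × Fin d) k ⧸ p)) (Ideal.Quotient.mk p f) := by
  have h : aeval (fun a : V × Fin d => genericPoint p a.1 a.2) =
      (IsScalarTower.toAlgHom k (MvPolynomial (V × Fin d) k ⧸ p)
        (FractionRing (MvPolynomial (V × Fin d) k ⧸ p))).comp (Ideal.Quotient.mkₐ k p) := by
    ext a
    simp [genericPoint]
  rw [h]
  rfl

variable [p.IsPrime]

lemma aeval_genericPoint_eq_zero {f : MvPolynomial (V × Fin d) k} :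
    aeval (fun a : V × Fin d => genericPoint p a.1 a.2) f = 0 ↔ f ∈ p := by
  rw [aeval_genericPoint, FaithfulSMul.algebraMap_eq_zero_iff, Ideal.Quotient.eq_zero_iff_mem]

lemma aeval_lssGen {K : Type*} [CommRing K] [Algebra k K] (x : V → Fin d → K) (i j : V) :
    aeval (fun a : V × Fin d => x a.1 a.2) (lssGen k d s(i, j)) = x i ⬝ᵥ x j := by
  simp [dotProduct]

/-- The relations among all coordinates of the generic point are exactly `p`, so the peeling bound
becomes a bound on `p.height`. -/
lemma blockHeight_genericPoint :
    blockHeight k (genericPoint p) Set.univ = p.height := by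
  rw [blockHeight, relHeight, Set.preimage_univ, relIdeal_univ]
  congr 1
  ext f
  rw [RingHom.mem_ker, aeval_genericPoint_eq_zero]

variable {p}

lemma genericPoint_dotProduct {G : SimpleGraph V} (hp : lssIdeal k d G ≤ p) {i j : V}
    (h : G.Adj i j) : genericPoint p i ⬝ᵥ genericPoint p j = 0 := by
  rw [← aeval_lssGen (k := k) (genericPoint p), aeval_genericPoint_eq_zero]
  exact hp (lssGen_mem k d (e := s(i, j)) h)

/-- If a vector vanishes at a minimal prime, then its neighbors span the whole space there:
otherwise the vector could be moved away from zero. -/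
theorem span_genericPoint_eq_top {G : SimpleGraph V} (hp : p ∈ (lssIdeal k d G).minimalPrimes)
    {u : V} (hu : genericPoint p u = 0) :
    Submodule.span (FractionRing (MvPolynomial (V × Fin d) k ⧸ p))
      (genericPoint p '' G.neighborSet u) = ⊤ := by
  classical
  set K := FractionRing (MvPolynomial (V × Fin d) k ⧸ p)
  by_contra hne
  obtain ⟨φ, hφ0, hφ⟩ := Submodule.exists_le_ker_of_lt_top _ (lt_top_iff_ne_top.2 hne)
  let y : Fin d → K := fun l => φ (Pi.single l 1)
  have hy : ∀ w : Fin d → K, φ w = y ⬝ᵥ w := fun w => by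
    conv_lhs => rw [pi_eq_sum_univ' w]
    simp [dotProduct, y, mul_comm, map_sum, map_smul]
  have hyw : ∀ w, G.Adj u w → y ⬝ᵥ genericPoint p w = 0 := fun w hw => by
    rw [← hy]
    exact hφ (Submodule.subset_span ⟨w, hw, rfl⟩)
  obtain ⟨l, hl⟩ : ∃ l, y l ≠ 0 := by
    by_contra! h
    apply hφ0
    ext w
    simp [y] at h
    simp [h]
  -- The zero vector at `u` is replaced by `t y`, with `y` normal to a hyperplane containing the
  -- neighbors. Orthogonality persists over `K[t]`, and `t = 0` recovers the generic point.
  let x' : V → Fin d → Polynomial K := fun i l =>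
    if i = u then Polynomial.C (y l) * Polynomial.X else Polynomial.C (genericPoint p i l)
  let ψ : MvPolynomial (V × Fin d) k →ₐ[k] Polynomial K := aeval (fun a : V × Fin d => x' a.1 a.2)
  have hprime : (RingHom.ker ψ).IsPrime := RingHom.ker_isPrime _
  have hI : lssIdeal k d G ≤ RingHom.ker ψ := by
    have hu' : ∀ w, G.Adj u w → ψ (lssGen k d s(u, w)) = 0 := fun w hw => by
      have h1 : x' u ⬝ᵥ x' w = Polynomial.C (y ⬝ᵥ genericPoint p w) * Polynomial.X := by
        simp only [x', dotProduct, if_true, if_neg hw.ne', map_sum, map_mul, Finset.sum_mul]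
        exact Finset.sum_congr rfl fun m _ => by ring
      rw [aeval_lssGen x', h1, hyw w hw]
      simp
    rw [lssIdeal_eq_span, Ideal.span_le]
    rintro _ ⟨e, he, rfl⟩
    induction e with | _ i j
    have hij : G.Adj i j := he
    rw [SetLike.mem_coe, RingHom.mem_ker]
    by_cases hi : i = u
    · subst hi
      exact hu' j hij
    by_cases hj : j = u
    · subst hj
      rw [Sym2.eq_swap]
      exact hu' i hij.symm
    have h1 : x' i ⬝ᵥ x' j = Polynomial.C (genericPoint p i ⬝ᵥ genericPoint p j) := by
      simp [x', dotProduct, hi, hj, map_sum]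
    rw [aeval_lssGen x', h1, genericPoint_dotProduct hp.1.2 hij, map_zero]
  have hle : RingHom.ker ψ ≤ p := by
    intro f hf
    rw [RingHom.mem_ker] at hf
    rw [← aeval_genericPoint_eq_zero]
    have h1 : aeval (fun a : V × Fin d => genericPoint p a.1 a.2) =
        ((Polynomial.aeval (0 : K)).restrictScalars k).comp ψ := by
      ext a
      by_cases ha : a.1 = u
      · have : genericPoint p u a.2 = 0 := congrFun hu _
        simp [ψ, x', ha, this]
      · simp [ψ, x', ha]
    rw [h1, AlgHom.comp_apply, hf, map_zero]
  have hXp : X (u, l) ∈ p := by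
    rw [← aeval_genericPoint_eq_zero, aeval_X]
    exact congrFun hu l
  -- Minimality forces the kernel of `ψ` to be `p`, yet `X (u, l)` maps to `y l * t ≠ 0`.
  have h1 : ψ (X (u, l)) = 0 := hp.2 ⟨hprime, hI⟩ hle hXp
  simp [ψ, x', hl] at h1

/-- At a minimal prime at which the vector of a vertex of large degree vanishes, one of the
generators is redundant. -/
theorem exists_mul_lssGen_mem [Fintype V] {G : SimpleGraph V} [DecidableRel G.Adj]
    (hp : p ∈ (lssIdeal k d G).minimalPrimes) {u : V} (hu : genericPoint p u = 0)
    (hdeg : d < G.degree u) :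
    ∃ e ∈ G.edgeSet, ∃ D : MvPolynomial (V × Fin d) k, D ∉ p ∧
      D * lssGen k d e ∈ Ideal.span (lssGen k d '' (G.edgeSet \ {e})) := by
  classical
  set K := FractionRing (MvPolynomial (V × Fin d) k ⧸ p)
  have hspan := span_genericPoint_eq_top hp hu
  obtain ⟨w, hw, hli⟩ : ∃ w : Fin d → V, (∀ j, G.Adj u (w j)) ∧
      LinearIndependent K (fun j => genericPoint p (w j)) := by
    obtain ⟨b, hb, hbs, hbl⟩ := exists_linearIndependent K (genericPoint p '' G.neighborSet u)
    rw [hspan] at hbs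
    let B := Module.Basis.mk hbl (by rw [Subtype.range_coe, hbs])
    let e := B.indexEquiv (Pi.basisFun K (Fin d))
    choose f hf using fun j => hb (e.symm j).2
    refine ⟨f, fun j => (hf j).1, ?_⟩
    have h1 : (fun j => genericPoint p (f j)) = (fun j => ((e.symm j : b) : Fin d → K)) := by
      ext1 j; exact (hf j).2
    rw [h1]
    exact hbl.comp _ e.symm.injective
  have hwinj : Function.Injective w := fun a b h => hli.injective (by simp only [h])
  let P : Matrix (Fin d) (Fin d) (MvPolynomial (V × Fin d) k) := Matrix.of fun j l => X (w j, l)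
  have hdet : P.det ∉ p := by
    rw [← aeval_genericPoint_eq_zero, AlgHom.map_det]
    have h1 : (aeval (fun a : V × Fin d => genericPoint p a.1 a.2)).mapMatrix P =
        Matrix.of fun j => genericPoint p (w j) := by
      ext j l
      simp [P]
    rw [h1]
    have h2 : LinearIndependent K (Matrix.of fun j => genericPoint p (w j)).row := hli
    rw [Matrix.linearIndependent_rows_iff_isUnit, Matrix.isUnit_iff_isUnit_det] at h2
    exact h2.ne_zero
  -- More than `d` neighbors leave one outside the chosen `d`; its edge carries the redundant
  -- generator.
  obtain ⟨w', hw', hnw⟩ : ∃ w', G.Adj u w' ∧ ∀ j, w j ≠ w' := by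
    by_contra! h
    have h1 : G.neighborFinset u ⊆ Finset.univ.image w := fun a ha => by
      obtain ⟨j, hj⟩ := h a ((G.mem_neighborFinset u a).1 ha)
      exact Finset.mem_image.2 ⟨j, Finset.mem_univ _, hj⟩
    have h2 := (Finset.card_le_card h1).trans Finset.card_image_le
    rw [SimpleGraph.card_neighborFinset_eq_degree, Finset.card_fin] at h2
    omega
  refine ⟨s(u, w'), hw', P.det, hdet, ?_⟩
  -- Cramer's rule: the entries of `P` times the vector of `u` are generators of other edges, and
  -- the adjugate turns `P` into `P.det`.
  have hmem : ∀ l, P.det * X (u, l) ∈ Ideal.span (lssGen k d '' (G.edgeSet \ {s(u, w')})) := by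
    intro l
    have h1 : P.adjugate.mulVec (P.mulVec fun l => X (u, l)) =
        P.det • (fun l => X (u, l)) := by
      rw [Matrix.mulVec_mulVec, Matrix.adjugate_mul, Matrix.smul_mulVec, Matrix.one_mulVec]
    have h2 := congrFun h1 l
    rw [Pi.smul_apply, smul_eq_mul] at h2
    rw [← h2, Matrix.mulVec, dotProduct]
    refine Ideal.sum_mem _ fun j _ => Ideal.mul_mem_left _ _ ?_
    have h3 : P.mulVec (fun l => (X (u, l) : MvPolynomial (V × Fin d) k)) j =
        lssGen k d s(u, w j) := by
      simp [Matrix.mulVec, dotProduct, P, mul_comm]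
    rw [h3]
    refine Ideal.subset_span ⟨s(u, w j), ⟨hw j, fun h => hnw j ?_⟩, rfl⟩
    exact Sym2.congr_right.1 h
  rw [lssGen_mk, Finset.mul_sum]
  refine Ideal.sum_mem _ fun l _ => ?_
  rw [← mul_assoc]
  exact Ideal.mul_mem_right _ _ (hmem l)

end MinimalPrimes

/-! ### Localization at a minimal prime. -/

section Localization

variable {R : Type*} [CommRing R] {I p : Ideal R} [p.IsPrime]

/-- The localized ideal has the maximal ideal as its radical, and height depends only on the
radical. -/
lemma height_map_localization_of_mem_minimalPrimes (hp : p ∈ I.minimalPrimes) :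
    (I.map (algebraMap R (Localization.AtPrime p))).height = p.height := by
  have h := IsLocalization.AtPrime.radical_map_of_mem_minimalPrimes
    (Localization.AtPrime p) p I hp
  rw [Ideal.height_eq_inf_minimalPrimes, ← Ideal.radical_minimalPrimes, h,
    ← Ideal.height_eq_inf_minimalPrimes]
  exact IsLocalization.height_map_of_disjoint p.primeCompl p
    (Set.disjoint_left.2 fun _ h1 h2 => h1 h2)

/-- A localization at a minimal prime is a complete intersection if it is generated by as many
elements as the height of the prime. -/
lemma isCompleteIntersection_map [IsNoetherianRing R] (hp : p ∈ I.minimalPrimes) {N : ℕ}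
    (hN : (N : ℕ∞) ≤ p.height)
    (hI : Submodule.spanFinrank (I.map (algebraMap R (Localization.AtPrime p))) ≤ N) :
    IsCompleteIntersection (I.map (algebraMap R (Localization.AtPrime p))) := by
  have hne : I.map (algebraMap R (Localization.AtPrime p)) ≠ ⊤ := by
    intro h
    have := IsLocalization.AtPrime.radical_map_of_mem_minimalPrimes
      (Localization.AtPrime p) p I hp
    rw [h, Ideal.radical_top] at this
    exact Ideal.IsPrime.ne_top' this.symm
  refine ⟨IsNoetherian.noetherian _, le_antisymm ?_ (Ideal.height_le_spanFinrank _ hne)⟩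
  rw [height_map_localization_of_mem_minimalPrimes hp]
  exact le_trans (by exact_mod_cast hI) hN

end Localization

/-! ### Degrees and edge counts. -/

section Degrees

variable {V : Type*}

lemma maxDeg_le_iff [Finite V] (G : SimpleGraph V) (d : ℕ) :
    maxDeg G ≤ d ↔ ∀ i, (G.neighborSet i).ncard ≤ d := by
  classical
  let := Fintype.ofFinite V
  have h : ∀ i, (G.neighborSet i).ncard = G.degree i := fun i => by
    rw [Set.ncard_eq_toFinset_card', ← SimpleGraph.card_neighborFinset_eq_degree]
    rfl
  simp_rw [h]
  unfold maxDeg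
  constructor
  · intro hm i
    refine le_trans ?_ hm
    convert! G.degree_le_maxDegree i
  · intro hm
    refine SimpleGraph.maxDegree_le_of_forall_degree_le _ _ fun i => ?_
    convert! hm i

variable [Fintype V] (G : SimpleGraph V)

lemma ncard_neighborSet_deleteEdges_le (s : Set (Sym2 V)) (i : V) :
    ((G.deleteEdges s).neighborSet i).ncard ≤ (G.neighborSet i).ncard :=
  Set.ncard_le_ncard (fun _ hj => (G.deleteEdges_le s) hj) (Set.toFinite _)

lemma ncard_neighborSet_deleteEdges_lt {a b : V} (h : G.Adj a b) :
    ((G.deleteEdges {s(a, b)}).neighborSet a).ncard < (G.neighborSet a).ncard := by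
  refine Set.ncard_lt_ncard ⟨fun _ hj => (G.deleteEdges_le _) hj, fun hcon => ?_⟩ (Set.toFinite _)
  have h1 : (G.deleteEdges {s(a, b)}).Adj a b := hcon h
  simp at h1

section

variable [DecidableRel G.Adj]

lemma degIn_univ (i : V) : degIn G Finset.univ i = (G.neighborSet i).ncard := by
  rw [degIn, Set.ncard_eq_toFinset_card']
  congr 1
  ext j
  simp

lemma degIn_le (W : Finset V) (i : V) : degIn G W i ≤ (G.neighborSet i).ncard := by
  rw [← degIn_univ]
  exact Finset.card_le_card (Finset.filter_subset_filter _ (Finset.subset_univ W))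

lemma edgesIn_univ : edgesIn G Finset.univ = G.edgeFinset.card := by
  rw [edgesIn]
  congr 1
  ext e
  simp

variable [DecidableEq V]

lemma card_edgeFinset_eq (i : V) :
    G.edgeFinset.card = edgesIn G {i}ᶜ + (G.neighborSet i).ncard := by
  rw [← edgesIn_univ, edgesIn_erase G (Finset.mem_univ i), degIn_univ]
  congr 2
  ext j
  simp

/-- Without the edge `ij`, no edge is counted at both `i` and `j`. -/
lemma card_edgeFinset_eq_of_not_adj {i j : V} (hij : i ≠ j) (h : ¬ G.Adj i j) :
    G.edgeFinset.card =
      edgesIn G {i, j}ᶜ + (G.neighborSet i).ncard + (G.neighborSet j).ncard := by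
  have hj : j ∈ ({i}ᶜ : Finset V) := by simp [hij.symm]
  rw [card_edgeFinset_eq G i, edgesIn_erase G hj]
  have h1 : degIn G {i}ᶜ j = (G.neighborSet j).ncard := by
    rw [← degIn_univ]
    unfold degIn
    congr 1
    ext l
    simp only [Finset.mem_filter, Finset.mem_compl, Finset.mem_singleton, Finset.mem_univ, true_and]
    exact ⟨fun hl => hl.2, fun hl => ⟨fun hli => h (hli ▸ hl.symm), hl⟩⟩
  have h2 : ({i}ᶜ : Finset V).erase j = {i, j}ᶜ := by
    ext l
    simp only [Finset.mem_erase, Finset.mem_compl, Finset.mem_singleton, Finset.mem_insert]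
    tauto
  rw [h1, h2]
  ring

end

end Degrees

/-! ### Almost complete intersections and deletion of one edge. -/

section AlmostCompleteIntersection

variable {k : Type*} [Field k] {V : Type*} [Fintype V] {d : ℕ} {G : SimpleGraph V}

/-- If the Lovász–Saks–Schrijver ideal is an almost complete intersection, then one edge is
responsible for all vertices of degree larger than `d`. -/
theorem exists_edge_of_isAlmostCompleteIntersection (hd : 0 < d) (htri : G.CliqueFree 3)
    (hdeg : d < maxDeg G) (h : IsAlmostCompleteIntersection (lssIdeal k d G)) :
    ∃ a b, G.Adj a b ∧ maxDeg (G.deleteEdges {s(a, b)}) ≤ d := by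
  classical
  -- The generator count exceeds the height by one, and the height is bounded through `Z`. One
  -- vertex bounds each degree by `d + 1`; two non-adjacent vertices of degree above `d` would
  -- exceed the bound.
  have hE : ∀ Z : Finset V, G.edgeFinset.card ≤ Z.card * d + edgesIn G Zᶜ + 1 := fun Z => by
    have h1 := h.2.1
    rw [spanFinrank_lssIdeal hd] at h1
    have h2 := add_le_add_left (height_lssIdeal_le (k := k) (d := d) G Z) 1
    rw [← h1] at h2
    exact_mod_cast h2
  have h1 : ∀ i, (G.neighborSet i).ncard ≤ d + 1 := fun i => by
    have h2 := hE {i}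
    rw [card_edgeFinset_eq G i, Finset.card_singleton] at h2
    omega
  have hadj : ∀ i j, i ≠ j → d < (G.neighborSet i).ncard → d < (G.neighborSet j).ncard →
      G.Adj i j := fun i j hij hi hj => by
    by_contra hna
    have h2 := hE {i, j}
    rw [card_edgeFinset_eq_of_not_adj G hij hna, Finset.card_pair hij] at h2
    omega
  obtain ⟨u, hu⟩ : ∃ u, d < (G.neighborSet u).ncard := by
    by_contra! hcon
    exact absurd ((maxDeg_le_iff G d).2 hcon) (by omega)
  obtain ⟨w, huw, hw⟩ : ∃ w, G.Adj u w ∧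
      ∀ i, d < (G.neighborSet i).ncard → i = u ∨ i = w := by
    by_cases hex : ∃ w, w ≠ u ∧ d < (G.neighborSet w).ncard
    · obtain ⟨w, hwu, hw⟩ := hex
      refine ⟨w, hadj u w hwu.symm hu hw, fun i hi => ?_⟩
      by_contra! hcon
      exact htri {u, w, i} (SimpleGraph.is3Clique_triple_iff.2
        ⟨hadj u w hwu.symm hu hw, hadj u i hcon.1.symm hu hi, hadj w i hcon.2.symm hw hi⟩)
    · push Not at hex
      -- With a single vertex of large degree, any edge at it will do.
      obtain ⟨w, hw⟩ := (Set.ncard_pos (Set.toFinite _)).1 (Nat.zero_lt_of_lt hu)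
      refine ⟨w, hw, fun i hi => Or.inl ?_⟩
      by_contra hne
      exact absurd (hex i hne) (by omega)
  refine ⟨u, w, huw, (maxDeg_le_iff _ _).2 fun i => ?_⟩
  by_contra! hi
  have hi' := hi.trans_le (ncard_neighborSet_deleteEdges_le G _ i)
  have hlt : ((G.deleteEdges {s(u, w)}).neighborSet i).ncard < (G.neighborSet i).ncard := by
    rcases hw i hi' with rfl | rfl
    · exact ncard_neighborSet_deleteEdges_lt G huw
    · rw [Sym2.eq_swap]
      exact ncard_neighborSet_deleteEdges_lt G huw.symm
  have := h1 i
  omega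

lemma edgesIn_le_height [DecidableEq V] [DecidableRel G.Adj] (hd : 4 ≤ d)
    (he : ∀ W : Finset V, W.Nonempty → edgesIn G W ≤ W.card + 1)
    (p : Ideal (MvPolynomial (V × Fin d) k)) [p.IsPrime] (hp : lssIdeal k d G ≤ p)
    (h0 : ∀ i, genericPoint p i = 0 → (G.neighborSet i).ncard ≤ d) :
    (edgesIn G Finset.univ : ℕ∞) ≤ p.height := by
  rw [← blockHeight_genericPoint p, ← Finset.coe_univ]
  exact edgesIn_le_blockHeight G hd (genericPoint p)
    (fun i j hij => genericPoint_dotProduct hp hij) he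
    (fun W i hi => (degIn_le G W i).trans (h0 i hi)) _

/-- The multiplier `D` becomes a unit in the localization, so the generator of `e` can be dropped.
-/
lemma spanFinrank_map_lssIdeal_le {p : Ideal (MvPolynomial (V × Fin d) k)} [p.IsPrime]
    {e : Sym2 V} (he : e ∈ G.edgeSet) {D : MvPolynomial (V × Fin d) k} (hD : D ∉ p)
    (hmem : D * lssGen k d e ∈ Ideal.span (lssGen k d '' (G.edgeSet \ {e}))) :
    Submodule.spanFinrank ((lssIdeal k d G).map (algebraMap _ (Localization.AtPrime p))) ≤
      (G.edgeSet \ {e}).ncard := by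
  set J := Ideal.span (lssGen k d '' (G.edgeSet \ {e})) with hJ
  have hfin : (lssGen k d '' (G.edgeSet \ {e})).Finite := Set.toFinite _
  have h1 : (lssIdeal k d G).map (algebraMap _ (Localization.AtPrime p)) =
      J.map (algebraMap _ (Localization.AtPrime p)) := by
    apply le_antisymm
    · rw [lssIdeal_eq_span, Ideal.map_span, Ideal.span_le]
      rintro _ ⟨_, ⟨e', he', rfl⟩, rfl⟩
      by_cases hee : e' = e
      · subst hee
        have hunit := IsLocalization.map_units (Localization.AtPrime p)
          (⟨D, hD⟩ : p.primeCompl)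
        have := Ideal.mem_map_of_mem (algebraMap _ (Localization.AtPrime p)) hmem
        rw [map_mul] at this
        exact (Ideal.unit_mul_mem_iff_mem _ hunit).1 this
      · exact Ideal.mem_map_of_mem _ (Ideal.subset_span ⟨e', ⟨he', hee⟩, rfl⟩)
    · refine Ideal.map_mono ?_
      rw [lssIdeal_eq_span]
      exact Ideal.span_mono (Set.image_mono Set.sdiff_subset)
  rw [h1]
  refine (Ideal.spanFinrank_map_le_of_fg _ (Submodule.fg_span hfin)).trans ?_
  exact (Submodule.spanFinrank_span_le_ncard_of_finite hfin).trans
    (Set.ncard_image_le (Set.toFinite _))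

/-- If one edge is responsible for all vertices of degree larger than `d` in a graph with few
cycles, then the Lovász–Saks–Schrijver ideal is an almost complete intersection. -/
theorem isAlmostCompleteIntersection_lssIdeal [DecidableEq V] [DecidableRel G.Adj] (hd : 4 ≤ d)
    (he : ∀ W : Finset V, W.Nonempty → edgesIn G W ≤ W.card + 1) (hdeg : d < maxDeg G) {a b : V}
    (hab : G.Adj a b) (hdel : maxDeg (G.deleteEdges {s(a, b)}) ≤ d) :
    IsAlmostCompleteIntersection (lssIdeal k d G) := by
  classical
  set H := G.deleteEdges {s(a, b)} with hH
  have hHG : H ≤ G := G.deleteEdges_le _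
  have hcard : ∀ e ∈ G.edgeSet, (G.edgeSet \ {e}).ncard + 1 = G.edgeFinset.card := fun e h => by
    rw [Set.ncard_sdiff_singleton_add_one h (Set.toFinite _), Set.ncard_eq_toFinset_card',
      SimpleGraph.edgeFinset]
  have hHcard : edgesIn H Finset.univ + 1 = G.edgeFinset.card := by
    rw [← hcard s(a, b) hab, edgesIn_univ, ← SimpleGraph.edgeSet_deleteEdges, ← hH,
      Set.ncard_eq_toFinset_card', SimpleGraph.edgeFinset]
  -- Such a prime also contains the ideal of `H`, whose degrees are at most `d`, so zero vectors do
  -- not obstruct peeling there.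
  have hlow : ∀ (p : Ideal (MvPolynomial (V × Fin d) k)) [p.IsPrime], lssIdeal k d G ≤ p →
      (edgesIn H Finset.univ : ℕ∞) ≤ p.height := fun p _ hp => by
    refine edgesIn_le_height hd (fun W hW => le_trans ?_ (he W hW)) p (le_trans ?_ hp)
      fun i _ => (maxDeg_le_iff H d).1 hdel i
    · exact Finset.card_le_card (Finset.monotone_filter_right _
        fun e _ h => SimpleGraph.edgeSet_mono hHG h)
    · rw [lssIdeal_eq_span, lssIdeal_eq_span]
      exact Ideal.span_mono (Set.image_mono (SimpleGraph.edgeSet_mono hHG))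
  have hht : (edgesIn H Finset.univ : ℕ∞) ≤ (lssIdeal k d G).height := by
    rw [Ideal.height_eq_inf_minimalPrimes]
    refine le_iInf₂ fun p hp => ?_
    have := hp.1.1
    exact hlow p hp.1.2
  refine ⟨lssIdeal_fg k d G, ?_, fun p _ hp => ?_⟩
  · rw [spanFinrank_lssIdeal (by omega)]
    apply le_antisymm
    · rw [← hHcard]
      push_cast
      exact add_le_add_left hht 1
    · obtain ⟨u, hu⟩ : ∃ u, d < (G.neighborSet u).ncard := by
        by_contra! hcon
        exact absurd ((maxDeg_le_iff G d).2 hcon) (by omega)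
      -- Killing the vector of `u` costs `d` and removes at least `d + 1` edges, so the height is at
      -- most `|E| - 1`.
      refine (add_le_add_left (height_lssIdeal_le G {u}) 1).trans ?_
      have := card_edgeFinset_eq G u
      rw [Finset.card_singleton]
      norm_cast
      omega
  -- If such a `u` exists, `|E| - 1` generators suffice locally and match `hlow`; otherwise peeling
  -- `G` itself gives height at least `|E|`.
  · by_cases hu : ∃ u, genericPoint p u = 0 ∧ d < (G.neighborSet u).ncard
    · obtain ⟨u, hu0, hu⟩ := hu
      obtain ⟨e, heG, D, hD, hmem⟩ := exists_mul_lssGen_mem hp hu0 (by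
        rwa [Set.ncard_eq_toFinset_card', Set.toFinset_card,
          SimpleGraph.card_neighborSet_eq_degree] at hu)
      refine isCompleteIntersection_map hp (hlow p hp.1.2)
        ((spanFinrank_map_lssIdeal_le heG hD hmem).trans ?_)
      have := hcard e heG
      omega
    · push Not at hu
      refine isCompleteIntersection_map hp (edgesIn_le_height hd he p hp.1.2 hu)
        ((Ideal.spanFinrank_map_le_of_fg _ (lssIdeal_fg k d G)).trans ?_)
      rw [spanFinrank_lssIdeal (by omega), edgesIn_univ]

end AlmostCompleteIntersection

/-! ### Cycles and the number of edges. -/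

section CycleEdges

variable {V : Type*}

/-- The edge sets of the cycles of a graph. -/
def cycleEdges (G : SimpleGraph V) : Set (Set (Sym2 V)) :=
  {S | ∃ (w : V) (p : G.Walk w w), p.IsCycle ∧ {e | e ∈ p.edges} = S}

lemma encard_cycles (G : SimpleGraph V) : (cycles G).encard = (cycleEdges G).encard := by
  have himg : cycleEdges G = SimpleGraph.Subgraph.edgeSet '' cycles G := by
    ext S
    constructor
    · rintro ⟨w, p, hp, rfl⟩
      refine ⟨_, ⟨w, p, hp, rfl⟩, ?_⟩
      ext e
      exact p.mem_edges_toSubgraph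
    · rintro ⟨_, ⟨w, p, hp, rfl⟩, rfl⟩
      refine ⟨w, p, hp, ?_⟩
      ext e
      exact p.mem_edges_toSubgraph.symm
  -- A cycle has no isolated vertices, so it is determined by its edges.
  have hverts : ∀ C ∈ cycles G, ∀ v, v ∈ C.verts ↔ ∃ w, C.Adj v w := by
    rintro _ ⟨w, p, hp, rfl⟩ v
    refine ⟨fun hv => ?_, fun ⟨_, h⟩ => h.fst_mem⟩
    have h2 := hp.ncard_neighborSet_toSubgraph_eq_two (p.mem_verts_toSubgraph.1 hv)
    obtain ⟨x, hx⟩ := Set.nonempty_of_ncard_ne_zero (by rw [h2]; decide)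
    exact ⟨x, hx⟩
  rw [himg, Set.InjOn.encard_image]
  intro C hC D hD h
  have hadj : C.Adj = D.Adj := by
    ext a b
    rw [← SimpleGraph.Subgraph.mem_edgeSet, ← SimpleGraph.Subgraph.mem_edgeSet, h]
  ext a b
  · rw [hverts C hC, hverts D hD, hadj]
  · rw [hadj]

lemma cycleEdges_mono {G H : SimpleGraph V} (h : H ≤ G) : cycleEdges H ⊆ cycleEdges G := by
  rintro _ ⟨w, p, hp, rfl⟩
  exact ⟨w, p.mapLe h, hp.mapLe h, by simp⟩

lemma isAcyclic_iff_cycleEdges (G : SimpleGraph V) : G.IsAcyclic ↔ cycleEdges G = ∅ := by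
  constructor
  · intro h
    by_contra! hne
    obtain ⟨_, w, p, hp, rfl⟩ := hne
    exact h p hp
  · intro h w p hp
    have : {e | e ∈ p.edges} ∈ cycleEdges G := ⟨w, p, hp, rfl⟩
    rw [h] at this
    exact this

lemma subset_edgeSet_of_mem_cycleEdges {G : SimpleGraph V} {S : Set (Sym2 V)}
    (hS : S ∈ cycleEdges G) : S ⊆ G.edgeSet := by
  obtain ⟨w, p, _, rfl⟩ := hS
  exact fun e he => p.edges_subset_edgeSet he

/-- A cycle through an edge consists of that edge and a path between its ends. -/
lemma exists_isPath_of_mem_edges {G : SimpleGraph V} {w a b : V} {p : G.Walk w w}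
    (hp : p.IsCycle) (he : s(a, b) ∈ p.edges) :
    ∃ q : G.Walk b a, q.IsPath ∧ s(a, b) ∉ q.edges ∧
      {e | e ∈ p.edges} = insert s(a, b) {e | e ∈ q.edges} := by
  classical
  have ha := p.fst_mem_support_of_mem_edges he
  have hrot : ∀ e, e ∈ (p.rotate a ha).edges ↔ e ∈ p.edges := fun e =>
    (p.rotate_edges a ha).mem_iff
  have hc := hp.rotate ha
  have key : ∀ c : G.Walk a a, c.IsCycle → c.snd = b → (∀ e, e ∈ c.edges ↔ e ∈ p.edges) →
      ∃ q : G.Walk b a, q.IsPath ∧ s(a, b) ∉ q.edges ∧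
        {e | e ∈ p.edges} = insert s(a, b) {e | e ∈ q.edges} := by
    intro c hc hsnd hce
    cases c with
    | nil => exact absurd hc SimpleGraph.Walk.not_isCycle_nil
    | cons h q =>
      simp only [SimpleGraph.Walk.snd_cons] at hsnd
      subst hsnd
      rw [SimpleGraph.Walk.cons_isCycle_iff] at hc
      refine ⟨q, hc.1, hc.2, ?_⟩
      ext e
      rw [Set.mem_ofPred_eq, ← hce, SimpleGraph.Walk.edges_cons, List.mem_cons]
      rfl
  have hb : b ∈ (p.rotate a ha).toSubgraph.neighborSet a := by
    rw [SimpleGraph.Subgraph.mem_neighborSet, SimpleGraph.Walk.adj_toSubgraph_iff_mem_edges, hrot]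
    exact he
  -- In the cycle rotated to start at `a`, the vertex `b` is second or penultimate; reversal reduces
  -- the latter case to the former.
  rw [hc.neighborSet_toSubgraph_endpoint] at hb
  rcases hb with hb | hb
  · exact key _ hc hb.symm hrot
  · refine key _ hc.reverse ?_ fun e => ?_
    · rw [SimpleGraph.Walk.snd_reverse]
      exact hb.symm
    · rw [SimpleGraph.Walk.edges_reverse, List.mem_reverse, hrot]

lemma card_edgeSet_deleteEdges [Finite V] {G : SimpleGraph V} {e : Sym2 V} (he : e ∈ G.edgeSet) :
    Nat.card (G.deleteEdges {e}).edgeSet + 1 = Nat.card G.edgeSet := by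
  rw [Nat.card_coe_set_eq, Nat.card_coe_set_eq, SimpleGraph.edgeSet_deleteEdges,
    Set.ncard_sdiff_singleton_add_one he (Set.toFinite _)]

lemma exists_connected_deleteEdges {G : SimpleGraph V} (hG : G.Connected) (hac : ¬ G.IsAcyclic) :
    ∃ a b, s(a, b) ∈ G.edgeSet ∧ (∃ S ∈ cycleEdges G, s(a, b) ∈ S) ∧
      (G.deleteEdges {s(a, b)}).Connected := by
  rw [SimpleGraph.isAcyclic_iff_forall_isBridge] at hac
  push Not at hac
  obtain ⟨e, he, hbr⟩ := hac
  induction e with | _ a b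
  have h1 := mt (SimpleGraph.isBridge_iff_forall_cycle_notMem he).2 hbr
  push Not at h1
  obtain ⟨w, p, hp, hep⟩ := h1
  exact ⟨a, b, he, ⟨_, ⟨w, p, hp, rfl⟩, hep⟩, hG.connected_delete_edge_of_not_isBridge hbr⟩

/-- A connected graph with as many edges as vertices is unicyclic. -/
theorem isUnicyclic_of_card [Finite V] {G : SimpleGraph V} (hG : G.Connected)
    (hcard : Nat.card G.edgeSet = Nat.card V) : IsUnicyclic G := by
  have hac : ¬ G.IsAcyclic := fun h => by
    have := (SimpleGraph.isTree_iff_connected_and_card.1 ⟨hG, h⟩).2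
    omega
  obtain ⟨a, b, he, ⟨S, hS, _⟩, hconn⟩ := exists_connected_deleteEdges hG hac
  have htree : (G.deleteEdges {s(a, b)}).IsTree :=
    SimpleGraph.isTree_iff_connected_and_card.2 ⟨hconn, by
      rw [card_edgeSet_deleteEdges he, hcard]⟩
  -- Deleting an edge of one cycle leaves a tree, so every cycle uses that edge and is closed up by
  -- the unique tree path between its ends.
  have hform : ∀ T ∈ cycleEdges G, ∃ q : (G.deleteEdges {s(a, b)}).Walk b a, q.IsPath ∧
      T = insert s(a, b) {e | e ∈ q.edges} := by
    rintro _ ⟨w, p, hp, rfl⟩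
    have hmem : s(a, b) ∈ p.edges := by
      by_contra hnot
      exact htree.isAcyclic _ (hp.toDeleteEdges _ {s(a, b)} (by
        rintro e he rfl
        exact hnot he))
    obtain ⟨q, hq, hqe, hT⟩ := exists_isPath_of_mem_edges hp hmem
    refine ⟨q.toDeleteEdges {s(a, b)} (by rintro e he rfl; exact hqe he),
      hq.toDeleteEdges _ _ _, ?_⟩
    rw [hT]
    simp [SimpleGraph.Walk.toDeleteEdges]
  rw [IsUnicyclic, encard_cycles, Set.encard_eq_one]
  refine ⟨S, Set.eq_singleton_iff_unique_mem.2 ⟨hS, fun T hT => ?_⟩⟩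
  obtain ⟨q, hq, rfl⟩ := hform S hS
  obtain ⟨q', hq', rfl⟩ := hform T hT
  have := htree.isAcyclic.subsingleton_path b a
  have h1 : q = q' := congrArg Subtype.val
    (Subsingleton.elim (⟨q, hq⟩ : (G.deleteEdges {s(a, b)}).Path b a) ⟨q', hq'⟩)
  rw [h1]

/-- Deleting an edge of a cycle keeps the graph connected and destroys at least one cycle; after at
most `m` deletions a tree remains. -/
lemma card_edgeSet_add_one_le [Finite V] (m : ℕ) {G : SimpleGraph V} (hG : G.Connected)
    (hm : (cycleEdges G).encard ≤ m) : Nat.card G.edgeSet + 1 ≤ Nat.card V + m := by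
  induction m generalizing G with
  | zero =>
    have hac : G.IsAcyclic := by
      rw [isAcyclic_iff_cycleEdges, ← Set.encard_eq_zero]
      exact le_antisymm (by simpa using hm) zero_le
    exact (SimpleGraph.isTree_iff_connected_and_card.1 ⟨hG, hac⟩).2.le
  | succ m ih =>
    by_cases hac : G.IsAcyclic
    · have := (SimpleGraph.isTree_iff_connected_and_card.1 ⟨hG, hac⟩).2
      omega
    obtain ⟨a, b, he, ⟨S, hS, hab⟩, hconn⟩ := exists_connected_deleteEdges hG hac
    have hsub : cycleEdges (G.deleteEdges {s(a, b)}) ⊆ cycleEdges G \ {S} := by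
      refine fun T hT => ⟨cycleEdges_mono (G.deleteEdges_le _) hT, ?_⟩
      rintro rfl
      have := subset_edgeSet_of_mem_cycleEdges hT hab
      simp at this
    have hle : (cycleEdges (G.deleteEdges {s(a, b)})).encard + 1 ≤ (m : ℕ∞) + 1 := by
      refine (add_le_add_left (Set.encard_le_encard hsub) 1).trans ?_
      rw [Set.encard_sdiff_singleton_add_one hS]
      exact_mod_cast hm
    have := ih hconn ((ENat.add_le_add_iff_right (by simp)).1 hle)
    have := card_edgeSet_deleteEdges he
    omega

/-- A connected bicyclic graph has one more edge than vertices. -/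
theorem card_edgeSet_of_isBicyclic [Finite V] {G : SimpleGraph V} (hG : G.Connected)
    (hb : IsBicyclic G) : Nat.card G.edgeSet = Nat.card V + 1 := by
  have hb' := hb
  rw [IsBicyclic, encard_cycles] at hb'
  have h1 := card_edgeSet_add_one_le 2 hG hb'.le
  have h2 := hG.card_vert_le_card_edgeSet_add_one
  -- The smaller edge counts are excluded: `|V|` edges would give one cycle, `|V| - 1` edges none.
  have h3 : Nat.card G.edgeSet ≠ Nat.card V := fun h => by
    have := isUnicyclic_of_card hG h
    rw [IsUnicyclic, hb] at this
    exact absurd this (by decide)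
  have h4 : Nat.card G.edgeSet + 1 ≠ Nat.card V := fun h => by
    have := (SimpleGraph.isTree_iff_connected_and_card.2 ⟨hG, h⟩).isAcyclic
    rw [isAcyclic_iff_cycleEdges] at this
    rw [this, Set.encard_empty] at hb'
    exact absurd hb' (by decide)
  omega

/-- If all cycles of a graph stay inside a set of vertices, then the induced graph has as many
cycles. -/
lemma encard_cycles_induce {G : SimpleGraph V} {B : Set V}
    (hB : ∀ (w : V) (p : G.Walk w w), p.IsCycle → ∀ x ∈ p.support, x ∈ B) :
    (cycles (G.induce B)).encard = (cycles G).encard := by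
  rw [encard_cycles, encard_cycles]
  have hinj : Function.Injective (Set.image (Sym2.map (Subtype.val : B → V))) :=
    (Sym2.map.injective Subtype.val_injective).image_injective
  have himg : cycleEdges G = Set.image (Sym2.map (Subtype.val : B → V)) ''
      cycleEdges (G.induce B) := by
    ext S
    constructor
    · rintro ⟨w, p, hp, rfl⟩
      have h := hB w p hp
      have hmap := p.map_induce h
      refine ⟨_, ⟨_, p.induce B h, ?_, rfl⟩, ?_⟩
      · apply SimpleGraph.Walk.IsCycle.of_map (f := (SimpleGraph.Embedding.induce B).toHom)
        rwa [hmap]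
      · have h2 := congrArg SimpleGraph.Walk.edges hmap
        rw [SimpleGraph.Walk.edges_map] at h2
        ext e
        exact List.mem_map.symm.trans (iff_of_eq (congrArg (e ∈ ·) h2))
    · rintro ⟨_, ⟨w, p, hp, rfl⟩, rfl⟩
      refine ⟨_, p.map (SimpleGraph.Embedding.induce B).toHom,
        hp.map (SimpleGraph.Embedding.induce (G := G) B).injective, ?_⟩
      ext e
      rw [Set.mem_ofPred_eq, SimpleGraph.Walk.edges_map, List.mem_map]
      rfl
  rw [himg, hinj.encard_image]

end CycleEdges

/-! ### The three forms and deletion of one edge. -/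

section BuiltByEdge

variable {V : Type*}

lemma mem_or_mem_of_isCompl {A B : Set V} (h : IsCompl A B) (x : V) : x ∈ A ∨ x ∈ B := by
  rw [← h.compl_eq]
  exact em _

lemma maxDeg_deleteEdges_le_of_eq_sup [Finite V] {G U : SimpleGraph V} {a b : V} {d : ℕ}
    (hab : a ≠ b) (hG : G = U ⊔ SimpleGraph.edge a b)
    (hU : ∀ i, (U.neighborSet i).ncard ≤ d) :
    ∃ a b, G.Adj a b ∧ maxDeg (G.deleteEdges {s(a, b)}) ≤ d := by
  refine ⟨a, b, ?_, (maxDeg_le_iff _ _).2 fun i => le_trans (Set.ncard_le_ncard ?_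
    (Set.toFinite _)) (hU i)⟩
  · rw [hG]
    exact Or.inr ((SimpleGraph.edge_adj _ _ _ _).2 ⟨Or.inl ⟨rfl, rfl⟩, hab⟩)
  · intro j hj
    rw [SimpleGraph.mem_neighborSet, hG, SimpleGraph.deleteEdges_adj, SimpleGraph.sup_adj,
      SimpleGraph.edge_adj] at hj
    obtain ⟨h | ⟨⟨rfl, rfl⟩ | ⟨rfl, rfl⟩, _⟩, hne⟩ := hj
    · exact h
    · exact absurd rfl hne
    · exact absurd Sym2.eq_swap hne

lemma ncard_neighborSet_map_sup_le [Finite V] {A B : Set V} (hAB : Disjoint A B)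
    {H₁ : SimpleGraph A} {H₂ : SimpleGraph B} {d : ℕ} (h₁ : maxDeg H₁ ≤ d) (i : V)
    (hi : i ∈ A) :
    ((H₁.map (Function.Embedding.subtype _) ⊔
      H₂.map (Function.Embedding.subtype _)).neighborSet i).ncard ≤ d := by
  have hsub : (H₁.map (Function.Embedding.subtype _) ⊔
      H₂.map (Function.Embedding.subtype _)).neighborSet i ⊆
      Subtype.val '' H₁.neighborSet ⟨i, hi⟩ := by
    intro j hj
    rw [SimpleGraph.mem_neighborSet, SimpleGraph.sup_adj, SimpleGraph.map_adj,
      SimpleGraph.map_adj] at hj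
    rcases hj with ⟨x, y, h, rfl, rfl⟩ | ⟨x, y, h, rfl, rfl⟩
    · exact ⟨y, h, rfl⟩
    · exact absurd x.2 (Set.disjoint_left.1 hAB hi)
  exact (Set.ncard_le_ncard hsub (Set.toFinite _)).trans
    ((Set.ncard_image_le (Set.toFinite _)).trans ((maxDeg_le_iff _ _).1 h₁ _))

lemma exists_edge_of_isEdgeJoin [Finite V] {G : SimpleGraph V} {A B : Set V}
    {H₁ : SimpleGraph A} {H₂ : SimpleGraph B} {d : ℕ} (h₁ : maxDeg H₁ ≤ d) (h₂ : maxDeg H₂ ≤ d)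
    (h : IsEdgeJoin G H₁ H₂) :
    ∃ a b, G.Adj a b ∧ maxDeg (G.deleteEdges {s(a, b)}) ≤ d := by
  obtain ⟨hc, a, b, hG⟩ := h
  refine maxDeg_deleteEdges_le_of_eq_sup ?_ hG fun i => ?_
  · intro hab
    exact Set.disjoint_left.1 hc.disjoint a.2 (hab ▸ b.2)
  · rcases mem_or_mem_of_isCompl hc i with hi | hi
    · exact ncard_neighborSet_map_sup_le hc.disjoint h₁ i hi
    · rw [sup_comm]
      exact ncard_neighborSet_map_sup_le hc.disjoint.symm h₂ i hi

/-- The edge to delete is the one that was added; only the degree bounds of the pieces matter. -/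
theorem exists_edge_of_isBuiltByEdge [Finite V]
    {Bic : ∀ ⦃W : Type _⦄, SimpleGraph W → Prop} {d : ℕ} {G : SimpleGraph V}
    (h : IsBuiltByEdge Bic d G) :
    ∃ a b, G.Adj a b ∧ maxDeg (G.deleteEdges {s(a, b)}) ≤ d := by
  rcases h with ⟨U, _, hU, a, b, hab, _, hG⟩ | ⟨A, B, U₁, U₂, _, h₁, _, h₂, h⟩ |
    ⟨A, B, U₁, U₂, _, h₁, _, h₂, h⟩
  · exact maxDeg_deleteEdges_le_of_eq_sup hab hG ((maxDeg_le_iff _ _).1 hU)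
  · exact exists_edge_of_isEdgeJoin h₁ h₂ h
  · exact exists_edge_of_isEdgeJoin h₁ h₂ h

/-- The vertices that are reachable from `a` after deleting the edge `ab`. -/
def bridgeSide (G : SimpleGraph V) (a b : V) : Set V :=
  {x | (G.deleteEdges {s(a, b)}).Reachable a x}

section Bridge

variable {G : SimpleGraph V} {a b : V}

lemma mem_bridgeSide_self : a ∈ bridgeSide G a b := SimpleGraph.Reachable.refl a

lemma adj_bridgeSide {x y : V} (hx : x ∈ bridgeSide G a b)
    (hxy : (G.deleteEdges {s(a, b)}).Adj x y) : y ∈ bridgeSide G a b :=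
  SimpleGraph.Reachable.trans hx hxy.reachable

/-- A common vertex would join `a` to `b` without the bridge. Along a walk from `a`, every edge
other than `ab` stays on its side, so the two sides cover everything. -/
lemma isCompl_bridgeSide (hG : G.Connected) (hbr : G.IsBridge s(a, b)) :
    IsCompl (bridgeSide G a b) (bridgeSide G b a) := by
  rw [SimpleGraph.isBridge_iff] at hbr
  constructor
  · rw [Set.disjoint_left]
    intro x hx hx'
    rw [bridgeSide, Sym2.eq_swap] at hx'
    exact hbr (SimpleGraph.Reachable.trans hx hx'.symm)
  · refine codisjoint_iff.2 (Set.eq_univ_iff_forall.2 fun x => ?_)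
    obtain ⟨p⟩ := hG a x
    induction p using SimpleGraph.Walk.concatRec with
    | Hnil => exact Or.inl mem_bridgeSide_self
    | @Hconcat u v w q h ih =>
      by_cases he : s(v, w) = s(u, b)
      · rcases Sym2.eq_iff.1 he with ⟨_, rfl⟩ | ⟨_, rfl⟩
        · exact Or.inr mem_bridgeSide_self
        · exact Or.inl mem_bridgeSide_self
      · rcases ih hbr with hv | hv
        · exact Or.inl (adj_bridgeSide hv (SimpleGraph.deleteEdges_adj.2 ⟨h, he⟩))
        · refine Or.inr (adj_bridgeSide hv (SimpleGraph.deleteEdges_adj.2 ⟨h, ?_⟩))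
          rw [Sym2.eq_swap (a := b)]
          exact he

lemma connected_induce_bridgeSide : (G.induce (bridgeSide G a b)).Connected := by
  have hset : ((G.deleteEdges {s(a, b)}).connectedComponentMk a).supp = bridgeSide G a b := by
    ext x
    rw [SimpleGraph.ConnectedComponent.mem_supp_iff, SimpleGraph.ConnectedComponent.eq]
    exact SimpleGraph.reachable_comm
  have h : ((G.deleteEdges {s(a, b)}).induce (bridgeSide G a b)).Connected := by
    rw [← hset]
    exact ((G.deleteEdges {s(a, b)}).connectedComponentMk a).connected_toSimpleGraph
  exact h.mono (SimpleGraph.comap_monotone _ (G.deleteEdges_le _))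

lemma eq_sup_edge_of_isBridge (hG : G.Connected) (hab : G.Adj a b) (hbr : G.IsBridge s(a, b)) :
    G = (G.induce (bridgeSide G a b)).map (Function.Embedding.subtype _) ⊔
      (G.induce (bridgeSide G b a)).map (Function.Embedding.subtype _) ⊔
        SimpleGraph.edge a b := by
  have hc := isCompl_bridgeSide hG hbr
  ext x y
  simp only [SimpleGraph.sup_adj, SimpleGraph.map_adj, SimpleGraph.edge_adj]
  constructor
  · intro h
    by_cases he : s(x, y) = s(a, b)
    · refine Or.inr ⟨?_, h.ne⟩
      simpa [eq_comm] using Sym2.eq_iff.1 he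
    · rcases mem_or_mem_of_isCompl hc x with hx | hx
      · exact Or.inl (Or.inl ⟨⟨x, hx⟩, ⟨y, adj_bridgeSide hx
          (SimpleGraph.deleteEdges_adj.2 ⟨h, he⟩)⟩, h, rfl, rfl⟩)
      · refine Or.inl (Or.inr ⟨⟨x, hx⟩, ⟨y, adj_bridgeSide hx
          (SimpleGraph.deleteEdges_adj.2 ⟨h, ?_⟩)⟩, h, rfl, rfl⟩)
        rw [Sym2.eq_swap (a := b)]
        exact he
  · rintro ((⟨x, y, h, rfl, rfl⟩ | ⟨x, y, h, rfl, rfl⟩) | ⟨⟨rfl, rfl⟩ | ⟨rfl, rfl⟩, _⟩)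
    · exact h
    · exact h
    · exact hab
    · exact hab.symm

lemma isEdgeJoin_of_isBridge (hG : G.Connected) (hab : G.Adj a b) (hbr : G.IsBridge s(a, b)) :
    IsEdgeJoin G (G.induce (bridgeSide G a b)) (G.induce (bridgeSide G b a)) :=
  ⟨isCompl_bridgeSide hG hbr, ⟨a, mem_bridgeSide_self⟩, ⟨b, mem_bridgeSide_self⟩,
    eq_sup_edge_of_isBridge hG hab hbr⟩

lemma ncard_map_subtype_edgeSet (A : Set V) (H : SimpleGraph A) :
    (H.map (Function.Embedding.subtype _)).edgeSet.ncard = Nat.card H.edgeSet := by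
  rw [SimpleGraph.edgeSet_map, Nat.card_coe_set_eq]
  exact Set.ncard_image_of_injective _ (Function.Embedding.injective _)

lemma card_edgeSet_of_isBridge [Finite V] (hG : G.Connected) (hab : G.Adj a b)
    (hbr : G.IsBridge s(a, b)) :
    Nat.card G.edgeSet = Nat.card (G.induce (bridgeSide G a b)).edgeSet +
      Nat.card (G.induce (bridgeSide G b a)).edgeSet + 1 := by
  have hc := isCompl_bridgeSide hG hbr
  rw [← ncard_map_subtype_edgeSet, ← ncard_map_subtype_edgeSet, Nat.card_coe_set_eq]
  conv_lhs => rw [eq_sup_edge_of_isBridge hG hab hbr]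
  rw [SimpleGraph.edgeSet_sup, SimpleGraph.edgeSet_sup, SimpleGraph.edgeSet_edge_of_ne hab.ne,
    Set.ncard_union_eq, Set.ncard_union_eq, Set.ncard_singleton]
  · rw [SimpleGraph.disjoint_edgeSet, SimpleGraph.disjoint_left]
    intro x y h h'
    rw [SimpleGraph.map_adj] at h h'
    obtain ⟨u, v, _, rfl, _⟩ := h
    obtain ⟨u', v', _, h, _⟩ := h'
    exact Set.disjoint_left.1 hc.disjoint u.2 (by
      have : (u' : V) = u := h
      exact this ▸ u'.2)
  · rw [Set.disjoint_singleton_right]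
    rintro (h | h)
    · obtain ⟨_, v, _, _, h2⟩ := (SimpleGraph.map_adj _ _ _ _).1 h
      exact Set.disjoint_left.1 hc.disjoint (Set.mem_of_eq_of_mem h2.symm v.2) mem_bridgeSide_self
    · obtain ⟨u, _, _, h2, _⟩ := (SimpleGraph.map_adj _ _ _ _).1 h
      exact Set.disjoint_left.1 hc.disjoint mem_bridgeSide_self (Set.mem_of_eq_of_mem h2.symm u.2)

lemma card_of_isBridge [Finite V] (hG : G.Connected) (hbr : G.IsBridge s(a, b)) :
    Nat.card V = Nat.card (bridgeSide G a b) + Nat.card (bridgeSide G b a) := by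
  have hc := isCompl_bridgeSide hG hbr
  rw [Nat.card_coe_set_eq, Nat.card_coe_set_eq, ← hc.compl_eq, Set.ncard_add_ncard_compl]

lemma maxDeg_induce_bridgeSide_le [Finite V] {d : ℕ} (hbr : G.IsBridge s(a, b))
    (hd : maxDeg (G.deleteEdges {s(a, b)}) ≤ d) : maxDeg (G.induce (bridgeSide G a b)) ≤ d := by
  rw [maxDeg_le_iff] at hd ⊢
  intro i
  refine le_trans ?_ (hd i)
  rw [← Set.ncard_image_of_injective _ Subtype.val_injective]
  refine Set.ncard_le_ncard ?_ (Set.toFinite _)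
  rintro _ ⟨j, hj, rfl⟩
  refine SimpleGraph.deleteEdges_adj.2 ⟨hj, fun h => ?_⟩
  have hb : b ∉ bridgeSide G a b := SimpleGraph.isBridge_iff.1 hbr
  rcases Sym2.eq_iff.1 h with ⟨_, h⟩ | ⟨h, _⟩
  · exact hb (Set.mem_of_eq_of_mem h.symm j.2)
  · exact hb (Set.mem_of_eq_of_mem h.symm i.2)

lemma isBridge_swap (hbr : G.IsBridge s(a, b)) : G.IsBridge s(b, a) := by
  rwa [Sym2.eq_swap]

/-- If one side of a bridge is a tree, then the other side contains all cycles. -/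
lemma encard_cycles_bridgeSide (hG : G.Connected) (hbr : G.IsBridge s(a, b))
    (hac : (G.induce (bridgeSide G a b)).IsAcyclic) :
    (cycles (G.induce (bridgeSide G b a))).encard = (cycles G).encard := by
  classical
  refine encard_cycles_induce fun w p hp => ?_
  -- A cycle avoids the bridge and so stays on one side, which cannot be the acyclic one.
  have hsupp : ∀ c e : V, s(c, e) = s(a, b) → w ∈ bridgeSide G c e →
      ∀ x ∈ p.support, x ∈ bridgeSide G c e := by
    intro c e hce hw x hx
    have hpe : s(c, e) ∉ p.edges := by
      rw [hce]
      exact hbr.notMem_edges_of_isCycle hp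
    refine SimpleGraph.Reachable.trans hw
      ⟨(p.takeUntil x hx).toDeleteEdges {s(c, e)} ?_⟩
    rintro e he rfl
    exact hpe (p.edges_takeUntil_subset_edges hx he)
  rcases mem_or_mem_of_isCompl (isCompl_bridgeSide hG hbr) w with hw | hw
  · have h := hsupp a b rfl hw
    have hmap := p.map_induce h
    refine absurd ?_ (hac (p.induce _ h))
    apply SimpleGraph.Walk.IsCycle.of_map
      (f := (SimpleGraph.Embedding.induce (bridgeSide G a b)).toHom)
    rwa [hmap]
  · exact hsupp b a Sym2.eq_swap hw

end Bridge

/-- The graphs in which deleting one edge bounds the degrees by `d` are those built by adding an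
edge to graphs with degrees at most `d`. -/
theorem isBuiltByEdge_of_exists_edge [Finite V]
    {Bic : ∀ ⦃W : Type _⦄, SimpleGraph W → Prop} {d : ℕ} {G : SimpleGraph V} (hG : G.Connected)
    (hcard : Nat.card G.edgeSet = Nat.card V + 1)
    (hBic : ∀ B : Set V, (G.induce B).Connected →
      Nat.card (G.induce B).edgeSet = Nat.card B + 1 →
      (cycles (G.induce B)).encard = (cycles G).encard → Bic (G.induce B))
    {a b : V} (hab : G.Adj a b) (hd : maxDeg (G.deleteEdges {s(a, b)}) ≤ d) :
    IsBuiltByEdge Bic d G := by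
  by_cases hbr : G.IsBridge s(a, b)
  -- The edge and vertex totals of the two sides agree, and each side has at least one edge fewer
  -- than vertices. So if one side is a tree, the other has one edge more than vertices (third
  -- form); otherwise both have equally many (second form). Stated for all `a`, `b` so that either
  -- side may be the tree.
  · have key : ∀ a b : V, G.Adj a b → G.IsBridge s(a, b) →
        maxDeg (G.deleteEdges {s(a, b)}) ≤ d →
        Nat.card (G.induce (bridgeSide G a b)).edgeSet + 1 = Nat.card (bridgeSide G a b) →
        IsBuiltByEdge Bic d G := by
      intro a b hab hbr hd h
      have htree : (G.induce (bridgeSide G a b)).IsTree :=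
        SimpleGraph.isTree_iff_connected_and_card.2 ⟨connected_induce_bridgeSide, h⟩
      have h1 := card_edgeSet_of_isBridge hG hab hbr
      have h2 := card_of_isBridge hG hbr
      refine Or.inr (Or.inr ⟨_, _, _, _, htree, maxDeg_induce_bridgeSide_le hbr hd,
        hBic _ connected_induce_bridgeSide (by omega)
          (encard_cycles_bridgeSide hG hbr htree.isAcyclic),
        maxDeg_induce_bridgeSide_le (isBridge_swap hbr) ?_,
        isEdgeJoin_of_isBridge hG hab hbr⟩)
      rwa [Sym2.eq_swap]
    have hd' : maxDeg (G.deleteEdges {s(b, a)}) ≤ d := by rwa [Sym2.eq_swap]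
    have hbr' := isBridge_swap hbr
    have hA := connected_induce_bridgeSide (G := G) (a := a) (b := b)
    have hB := connected_induce_bridgeSide (G := G) (a := b) (b := a)
    have h1 := card_edgeSet_of_isBridge hG hab hbr
    have h2 := card_of_isBridge hG hbr
    have h3 := hA.card_vert_le_card_edgeSet_add_one
    have h4 := hB.card_vert_le_card_edgeSet_add_one
    by_cases hA' : Nat.card (G.induce (bridgeSide G a b)).edgeSet + 1 =
        Nat.card (bridgeSide G a b)
    · exact key a b hab hbr hd hA'
    by_cases hB' : Nat.card (G.induce (bridgeSide G b a)).edgeSet + 1 =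
        Nat.card (bridgeSide G b a)
    · exact key b a hab.symm hbr' hd' hB'
    exact Or.inr (Or.inl ⟨_, _, _, _, isUnicyclic_of_card hA (by omega),
      maxDeg_induce_bridgeSide_le hbr hd, isUnicyclic_of_card hB (by omega),
      maxDeg_induce_bridgeSide_le hbr' hd', isEdgeJoin_of_isBridge hG hab hbr⟩)
  -- Deleting a non-bridge leaves a connected graph with as many edges as vertices, hence a
  -- unicyclic one.
  · have h1 := card_edgeSet_deleteEdges (G := G) (e := s(a, b)) hab
    refine Or.inl ⟨G.deleteEdges {s(a, b)},
      isUnicyclic_of_card (hG.connected_delete_edge_of_not_isBridge hbr) (by omega), hd,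
      a, b, hab.ne, by simp, ?_⟩
    ext x y
    rw [SimpleGraph.sup_adj, SimpleGraph.deleteEdges_adj, SimpleGraph.edge_adj]
    constructor
    · intro h
      by_cases he : s(x, y) = s(a, b)
      · refine Or.inr ⟨?_, h.ne⟩
        simpa [eq_comm] using Sym2.eq_iff.1 he
      · exact Or.inl ⟨h, he⟩
    · rintro (h | ⟨⟨rfl, rfl⟩ | ⟨rfl, rfl⟩, _⟩)
      · exact h.1
      · exact hab
      · exact hab.symm

end BuiltByEdge

/-! ### Sparsity of vertex subsets and the main theorem. -/

section Sparse

variable {V : Type*} [Fintype V] [DecidableEq V] {G : SimpleGraph V} [DecidableRel G.Adj]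

/-- Every set of vertices of a connected graph with at most one more edge than vertices has this
property as well. -/
lemma edgesIn_le_card_add_one (hG : G.Connected) (hcard : Nat.card G.edgeSet ≤ Nat.card V + 1)
    (W : Finset V) (hW : W.Nonempty) : edgesIn G W ≤ W.card + 1 := by
  induction hn : (Wᶜ).card generalizing W with
  | zero =>
    obtain rfl : W = Finset.univ := by simpa using hn
    rw [edgesIn_univ, Finset.card_univ, ← Nat.card_eq_fintype_card]
    refine le_trans (le_of_eq ?_) hcard
    rw [SimpleGraph.edgeFinset, Set.toFinset_card, Nat.card_eq_fintype_card]
  | succ n ih =>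
    obtain ⟨y, hy⟩ := Finset.card_pos.1 (show 0 < (Wᶜ).card by omega)
    obtain ⟨x, hx⟩ := hW
    obtain ⟨p⟩ := hG x y
    -- Connectivity supplies a vertex outside `W` with a neighbor in `W`. Adding it brings one
    -- vertex and at least one edge, so a bound for the larger set passes down to `W`.
    obtain ⟨e, _, he1, he2⟩ := p.exists_boundary_dart (W : Set V) hx (by simpa using hy)
    have hi : e.snd ∉ W := he2
    have h1 := ih (insert e.snd W) (Finset.insert_nonempty _ _) (by
      rw [Finset.compl_insert, Finset.card_erase_of_mem (by simpa using hi), hn]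
      rfl)
    rw [edgesIn_insert G hi, Finset.card_insert_of_notMem hi] at h1
    have h2 : 0 < degIn G W e.snd :=
      Finset.card_pos.2 ⟨e.fst, Finset.mem_filter.2 ⟨he1, e.adj.symm⟩⟩
    omega

end Sparse

/-- The characterization for connected triangle-free graphs with one more edge than vertices, for
any notion of bicyclic graph that passes to one side of a bridge. -/
theorem lssIdeal_isAlmostCompleteIntersection_iff {k : Type*} [Field k] {V : Type*} [Finite V]
    {Bic : ∀ ⦃W : Type _⦄, SimpleGraph W → Prop} {d : ℕ} {G : SimpleGraph V}
    (hG : G.Connected) (htri : G.CliqueFree 3) (hd : 4 ≤ d) (hdeg : d < maxDeg G)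
    (hcard : Nat.card G.edgeSet = Nat.card V + 1)
    (hBic : ∀ B : Set V, (G.induce B).Connected →
      Nat.card (G.induce B).edgeSet = Nat.card B + 1 →
      (cycles (G.induce B)).encard = (cycles G).encard → Bic (G.induce B)) :
    IsAlmostCompleteIntersection (lssIdeal k d G) ↔ IsBuiltByEdge Bic d G := by
  classical
  have := Fintype.ofFinite V
  constructor
  · intro h
    obtain ⟨a, b, hab, hdel⟩ :=
      exists_edge_of_isAlmostCompleteIntersection (by omega) htri hdeg h
    exact isBuiltByEdge_of_exists_edge hG hcard hBic hab hdel
  · intro h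
    obtain ⟨a, b, hab, hdel⟩ := exists_edge_of_isBuiltByEdge h
    exact isAlmostCompleteIntersection_lssIdeal hd (edgesIn_le_card_add_one hG hcard.le) hdeg
      hab hdel

end LSS

theorem mainTheorem5 {k : Type*} [Field k] (n d : ℕ) (G : SimpleGraph (Fin n))
    (hconn : G.Connected) (htri : G.CliqueFree 3) (hd : 4 ≤ d) (hdeg : d < LSS.maxDeg G) :
    (LSS.IsBicyclic G →
      (LSS.IsAlmostCompleteIntersection (LSS.lssIdeal k d G) ↔
        LSS.IsBuiltByEdge (fun _ K => LSS.IsBicyclic K) d G)) ∧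
    (LSS.IsCyclomaticBicyclic G →
      (LSS.IsAlmostCompleteIntersection (LSS.lssIdeal k d G) ↔
        LSS.IsBuiltByEdge (fun _ K => LSS.IsCyclomaticBicyclic K) d G)) := by
  constructor
  · intro hb
    refine LSS.lssIdeal_isAlmostCompleteIntersection_iff hconn htri hd hdeg
      (LSS.card_edgeSet_of_isBicyclic hconn hb) fun B _ _ h => ?_
    rw [LSS.IsBicyclic, h]
    exact hb
  · intro hb
    have hcard : ∀ {W : Type} [Finite W] (K : SimpleGraph W),
        K.edgeSet.encard = ENat.card W + 1 ↔ Nat.card K.edgeSet = Nat.card W + 1 := by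
      intro W _ K
      rw [Nat.card_coe_set_eq, ← (Set.toFinite K.edgeSet).cast_ncard_eq, ENat.card_eq_coe_natCard]
      norm_cast
    exact LSS.lssIdeal_isAlmostCompleteIntersection_iff hconn htri hd hdeg
      ((hcard G).1 hb.2) fun B hB h _ => ⟨hB, (hcard _).2 h⟩
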